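/- Let $G=(A,\Delta)$ be a locally compact quantum group with dual $\widehat G=(\widehat A,\widehat\Delta)$, constructed from a modular (for instance manageable) multiplicative unitary $W\in \mathrm B(H\otimes H)$, $W_{23}W_{12}=W_{12}W_{13}W_{23}$: the $C^*$-algebras $A,\widehat A\subset \mathrm B(H)$ are the norm closures of $\{(\omega\otimes\mathrm{id})W\}$ and $\{(\mathrm{id}\otimes\omega)W\}$, where $\omega\in \mathrm B(H)_*$, one has $W\in \mathrm M(\widehat A\otimes A)$, and $\Delta(a)=W(a\otimes 1)W^*$, $\widehat\Delta(\hat a)=\Sigma W^*(1\otimes\hat a)W\Sigma$, where $\Sigma$ is the flip of $H\otimes H$. Here $\otimes$ between $C^*$-algebras is the minimal tensor product, $\mathrm M(\cdot)$ is the multiplier algebra, $XY$ denotes the closed linear span of the products $xy$ with $x\in X$, $y\in Y$, and $\mathrm{Mor}(X,Y)$ is the set of $^*$-homomorphisms $\varphi:X\to \mathrm M(Y)$ with $\varphi(X)Y=Y$; such $\varphi$ are extended to unital $^*$-homomorphisms $\mathrm M(X)\to \mathrm M(Y)$. A continuous left action of $\widehat G$ on a $C^*$-algebra $B$ is an injective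 $\beta\in\mathrm{Mor}(B,\widehat A\otimes B)$ such that $(\mathrm{id}\otimes\beta)\beta=(\widehat\Delta\otimes\mathrm{id})\beta$ and $(\widehat A\otimes 1)\beta(B)=\widehat A\otimes B$. A $G$-product is a triple $(B,\beta,\psi)$ in which $B$ is a $C^*$-algebra, $\beta$ is a continuous left action of $\widehat G$ on $B$, and $\psi\in\mathrm{Mor}(\widehat A,B)$ is injective and satisfies $\beta\psi=(\mathrm{id}\otimes\psi)\widehat\Delta$. Let $\Omega\in \mathrm M(\widehat A\otimes\widehat A)$ be a unitary 2-cocycle, that is, a unitary with $$(\Omega\otimes 1)(\widehat\Delta\otimes\mathrm{id})(\Omega)=(1\otimes\Omega)(\mathrm{id}\otimes\widehat\Delta)(\Omega),$$ whose Drinfeld twist is trivial, that is, $\Omega^*\widehat\Delta(\hat a)\Omega=\widehat\Delta(\hat a)$ for all $\hat a\in\widehat A$. Let $(B,\beta,\psi)$ be a $G$-product and put $\Omega_{1\psi}=(\mathrm{id}\otimes\psi)(\Omega)\in \mathrm M(\widehat A\otimes B)$ and $$\beta^{\Omega}(b)=\Omega_{1\psi}^{*}\,\beta(b)\,\Omega_{1\psi}\qquad(b\in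 B).$$ Then $\beta^\Omega(b)\in \mathrm M(\widehat A\otimes B)$ for all $b\in B$, $\beta^\Omega\in\mathrm{Mor}(B,\widehat A\otimes B)$ is a continuous left action of $\widehat G$ on $B$, and $(B,\beta^\Omega,\psi)$ is again a $G$-product. -/

import Mathlib

open scoped TensorProduct InnerProductSpace

set_option linter.unusedSectionVars false

noncomputable section

namespace QG

section HilbertTensor

variable {H H' H'' : Type*} [NormedAddCommGroup H] [InnerProductSpace ℂ H]
  [NormedAddCommGroup H'] [InnerProductSpace ℂ H'] [NormedAddCommGroup H''] [InnerProductSpace ℂ H'']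
  {K K' K'' : Type*} [NormedAddCommGroup K] [InnerProductSpace ℂ K]
  [NormedAddCommGroup K'] [InnerProductSpace ℂ K'] [NormedAddCommGroup K''] [InnerProductSpace ℂ K'']
  {L : Type*} [NormedAddCommGroup L] [InnerProductSpace ℂ L]

/-- The Hilbert space tensor product: the completion of the algebraic tensor product. -/
abbrev HTensor (H K : Type*) [NormedAddCommGroup H] [InnerProductSpace ℂ H]
    [NormedAddCommGroup K] [InnerProductSpace ℂ K] : Type _ :=
  UniformSpace.Completion (H ⊗[ℂ] K)

/-- The elementary tensor `x ⊗ y` in the Hilbert space tensor product. -/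
def tm (x : H) (y : K) : HTensor H K := ((x ⊗ₜ[ℂ] y : H ⊗[ℂ] K) : HTensor H K)

/-- The operator `y ↦ x ⊗ y`. -/
def insL (x : H) : K →L[ℂ] HTensor H K :=
  (UniformSpace.Completion.toComplL (𝕜 := ℂ) (E := H ⊗[ℂ] K)).comp (TensorProduct.mkL ℂ H K x)

/-- The operator `x ↦ x ⊗ y`. -/
def insR (y : K) : H →L[ℂ] HTensor H K :=
  (UniformSpace.Completion.toComplL (𝕜 := ℂ) (E := H ⊗[ℂ] K)).comp
    ((TensorProduct.mkL ℂ H K).flip y)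

/-- The tensor product `a ⊗ b` of bounded operators. -/
def opT (a : H →L[ℂ] H') (b : K →L[ℂ] K') : HTensor H K →L[ℂ] HTensor H' K' :=
  (TensorProduct.mapL a b).completion

@[simp] lemma insL_apply (x : H) (y : K) : insL x y = tm x y := rfl

@[simp] lemma insR_apply (x : H) (y : K) : insR y x = tm x y := rfl

@[simp] lemma inner_tm (x x' : H) (y y' : K) :
    ⟪tm x y, tm x' y'⟫_ℂ = ⟪x, x'⟫_ℂ * ⟪y, y'⟫_ℂ := by
  simp [tm]

@[simp] lemma opT_tm (a : H →L[ℂ] H') (b : K →L[ℂ] K') (x : H) (y : K) :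
    opT a b (tm x y) = tm (a x) (b y) := by
  simp [opT, tm]

/-- Induction principle: a closed linear property that holds on elementary tensors holds. -/
lemma span_tm_dense : closure (Submodule.span ℂ {v : HTensor H K | ∃ x y, v = tm x y} :
    Set (HTensor H K)) = Set.univ := by
  rw [Set.eq_univ_iff_forall]
  intro v
  refine UniformSpace.Completion.induction_on v isClosed_closure fun t => subset_closure ?_
  induction t using TensorProduct.induction_on with
  | zero => exact Submodule.zero_mem _
  | tmul x y => exact Submodule.subset_span ⟨x, y, rfl⟩
  | add s t hs ht =>
    rw [UniformSpace.Completion.coe_add]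
    exact Submodule.add_mem _ hs ht

lemma ext_tm {E : Type*} [NormedAddCommGroup E] [NormedSpace ℂ E]
    {f g : HTensor H K →L[ℂ] E} (h : ∀ x y, f (tm x y) = g (tm x y)) : f = g := by
  apply ContinuousLinearMap.ext_on (s := {v : HTensor H K | ∃ x y, v = tm x y})
  · rw [dense_iff_closure_eq]; exact span_tm_dense
  · rintro _ ⟨x, y, rfl⟩; exact h x y

lemma ext_inner_tm {u v : HTensor H K} (h : ∀ x y, ⟪tm x y, u⟫_ℂ = ⟪tm x y, v⟫_ℂ) : u = v := by
  have : innerSL ℂ u = innerSL ℂ v := by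
    apply ext_tm
    intro x y
    have := congrArg (starRingEnd ℂ) (h x y)
    simpa [innerSL_apply_apply, inner_conj_symm] using this
  exact ext_inner_right ℂ fun w => by
    simpa [innerSL_apply_apply] using congrArg (fun f => f w) this

lemma opT_comp (a : H →L[ℂ] H') (b : K →L[ℂ] K') (a' : H' →L[ℂ] H'') (b' : K' →L[ℂ] K'') :
    (opT a' b').comp (opT a b) = opT (a'.comp a) (b'.comp b) :=
  ext_tm fun x y => by simp

lemma opT_mul (a a' : H →L[ℂ] H) (b b' : K →L[ℂ] K) :
    opT a b * opT a' b' = opT (a * a') (b * b') :=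
  opT_comp a' b' a b

lemma tm_add_left (x x' : H) (y : K) : tm (x + x') y = tm x y + tm x' y :=
  map_add (insR y : H →L[ℂ] HTensor H K) x x'

lemma tm_add_right (x : H) (y y' : K) : tm x (y + y') = tm x y + tm x y' :=
  map_add (insL x : K →L[ℂ] HTensor H K) y y'

lemma tm_smul_left (c : ℂ) (x : H) (y : K) : tm (c • x) y = c • tm x y :=
  map_smul (insR y : H →L[ℂ] HTensor H K) c x

lemma tm_smul_right (c : ℂ) (x : H) (y : K) : tm x (c • y) = c • tm x y :=
  map_smul (insL x : K →L[ℂ] HTensor H K) c y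

@[simp] lemma opT_one : opT (1 : H →L[ℂ] H) (1 : K →L[ℂ] K) = 1 :=
  ext_tm fun x y => by simp

/-- The flip unitary `x ⊗ y ↦ y ⊗ x`. -/
def flipH (H K : Type*) [NormedAddCommGroup H] [InnerProductSpace ℂ H]
    [NormedAddCommGroup K] [InnerProductSpace ℂ K] : HTensor H K →L[ℂ] HTensor K H :=
  ((TensorProduct.commIsometry ℂ H K).toContinuousLinearEquiv : H ⊗[ℂ] K →L[ℂ] K ⊗[ℂ] H).completion

@[simp] lemma flipH_tm (x : H) (y : K) : flipH H K (tm x y) = tm y x := by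
  simp [flipH, tm]

variable [CompleteSpace H] [CompleteSpace K]

lemma star_opT (a : H →L[ℂ] H) (b : K →L[ℂ] K) : star (opT a b) = opT (star a) (star b) := by
  refine ext_tm fun x y => ext_inner_tm fun x' y' => ?_
  simp [ContinuousLinearMap.star_eq_adjoint, ContinuousLinearMap.adjoint_inner_right]

end HilbertTensor

section Associator

variable (H K L : Type*) [NormedAddCommGroup H] [InnerProductSpace ℂ H]
  [NormedAddCommGroup K] [InnerProductSpace ℂ K] [NormedAddCommGroup L] [InnerProductSpace ℂ L]

/-- The isometric inclusion of `(H ⊗ K) ⊗ L` (algebraic) in the Hilbert space `(H ⊗ K) ⊗ L`. -/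
def inclL : ((H ⊗[ℂ] K) ⊗[ℂ] L) →ₗᵢ[ℂ] HTensor (HTensor H K) L :=
  (UniformSpace.Completion.toComplₗᵢ (𝕜 := ℂ)).comp
    (TensorProduct.mapIsometry (UniformSpace.Completion.toComplₗᵢ (𝕜 := ℂ)) LinearIsometry.id)

/-- The isometric inclusion of `H ⊗ (K ⊗ L)` (algebraic) in the Hilbert space `H ⊗ (K ⊗ L)`. -/
def inclR : (H ⊗[ℂ] (K ⊗[ℂ] L)) →ₗᵢ[ℂ] HTensor H (HTensor K L) :=
  (UniformSpace.Completion.toComplₗᵢ (𝕜 := ℂ)).comp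
    (TensorProduct.mapIsometry LinearIsometry.id (UniformSpace.Completion.toComplₗᵢ (𝕜 := ℂ)))

variable {H K L}

lemma inclL_tmul (t : H ⊗[ℂ] K) (z : L) : inclL H K L (t ⊗ₜ z) = tm (t : HTensor H K) z := rfl

lemma inclR_tmul (x : H) (t : K ⊗[ℂ] L) : inclR H K L (x ⊗ₜ t) = tm x (t : HTensor K L) := rfl

variable (H K L)

lemma denseRange_inclL : DenseRange (inclL H K L) := by
  have key : ∀ v : HTensor (HTensor H K) L,
      v ∈ (LinearMap.range (inclL H K L).toLinearMap).topologicalClosure := by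
    intro v
    refine UniformSpace.Completion.induction_on v
      (Submodule.isClosed_topologicalClosure _) fun t => ?_
    induction t using TensorProduct.induction_on with
    | zero => exact Submodule.zero_mem _
    | tmul x y =>
      refine UniformSpace.Completion.induction_on x ?_ fun s => ?_
      · exact (Submodule.isClosed_topologicalClosure _).preimage
          (insR (H := HTensor H K) y).continuous
      · exact subset_closure ⟨s ⊗ₜ y, rfl⟩
    | add s t hs ht =>
      rw [UniformSpace.Completion.coe_add]
      exact Submodule.add_mem _ hs ht
  intro v
  exact key v

lemma denseRange_inclR : DenseRange (inclR H K L) := by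
  have key : ∀ v : HTensor H (HTensor K L),
      v ∈ (LinearMap.range (inclR H K L).toLinearMap).topologicalClosure := by
    intro v
    refine UniformSpace.Completion.induction_on v
      (Submodule.isClosed_topologicalClosure _) fun t => ?_
    induction t using TensorProduct.induction_on with
    | zero => exact Submodule.zero_mem _
    | tmul x y =>
      refine UniformSpace.Completion.induction_on y ?_ fun s => ?_
      · exact (Submodule.isClosed_topologicalClosure _).preimage
          (insL (K := HTensor K L) x).continuous
      · exact subset_closure ⟨x ⊗ₜ s, rfl⟩
    | add s t hs ht =>
      rw [UniformSpace.Completion.coe_add]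
      exact Submodule.add_mem _ hs ht
  intro v
  exact key v

lemma norm_assoc_incl (t : (H ⊗[ℂ] K) ⊗[ℂ] L) :
    ‖(inclR H K L).toLinearMap (TensorProduct.assoc ℂ H K L t)‖ = ‖(inclL H K L).toLinearMap t‖ :=
  ((inclR H K L).norm_map _).trans
    ((TensorProduct.norm_assoc t).trans ((inclL H K L).norm_map t).symm)

/-- The associativity unitary `(x ⊗ y) ⊗ z ↦ x ⊗ (y ⊗ z)`. -/
def assocH : HTensor (HTensor H K) L ≃ₗᵢ[ℂ] HTensor H (HTensor K L) :=
  (TensorProduct.assoc ℂ H K L).extendOfIsometry (inclL H K L).toLinearMap (inclR H K L).toLinearMap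
    (denseRange_inclL H K L) (denseRange_inclR H K L) (norm_assoc_incl H K L)

variable {H K L}

@[simp] lemma assocH_tm (x : H) (y : K) (z : L) :
    assocH H K L (tm (tm x y) z) = tm x (tm y z) := by
  have := LinearEquiv.extendOfIsometry_eq (f := TensorProduct.assoc ℂ H K L)
    (e₁ := (inclL H K L).toLinearMap) (e₂ := (inclR H K L).toLinearMap)
    (denseRange_inclL H K L) (denseRange_inclR H K L) (norm_assoc_incl H K L)
    ((x ⊗ₜ y) ⊗ₜ z)
  exact this

/-- The identification of operators on `(H ⊗ K) ⊗ L` with operators on `H ⊗ (K ⊗ L)`. -/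
def reassoc (X : HTensor (HTensor H K) L →L[ℂ] HTensor (HTensor H K) L) :
    HTensor H (HTensor K L) →L[ℂ] HTensor H (HTensor K L) :=
  (assocH H K L).toContinuousLinearEquiv.toContinuousLinearMap.comp
    (X.comp (assocH H K L).symm.toContinuousLinearEquiv.toContinuousLinearMap)

lemma reassoc_opT (a : H →L[ℂ] H) (b : K →L[ℂ] K) (c : L →L[ℂ] L) :
    reassoc (opT (opT a b) c) = opT a (opT b c) := by
  have h : ∀ (x : H) (y : K) (z : L),
      (assocH H K L).symm (tm x (tm y z)) = tm (tm x y) z := fun x y z => by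
    rw [LinearIsometryEquiv.symm_apply_eq, assocH_tm]
  have : (reassoc (opT (opT a b) c)).comp (assocH H K L).toContinuousLinearEquiv.toContinuousLinearMap =
      (opT a (opT b c)).comp (assocH H K L).toContinuousLinearEquiv.toContinuousLinearMap := by
    refine ext_tm fun u z => ?_
    have h2 : (((reassoc (opT (opT a b) c)).comp
        (assocH H K L).toContinuousLinearEquiv.toContinuousLinearMap).comp (insR z)) =
        (((opT a (opT b c)).comp
        (assocH H K L).toContinuousLinearEquiv.toContinuousLinearMap).comp (insR z)) := by
      refine ext_tm fun x y => ?_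
      simp [reassoc, h]
    exact congrArg (fun f => f u) h2
  ext v
  obtain ⟨w, rfl⟩ := (assocH H K L).surjective v
  exact congrArg (fun f => f w) this

end Associator

/-- The norm closed linear span of a set. -/
def cls {E : Type*} [NormedAddCommGroup E] [NormedSpace ℂ E] (S : Set E) : Set E :=
  closure (Submodule.span ℂ S : Set E)

section ClosedSpan

variable {E F : Type*} [NormedAddCommGroup E] [NormedSpace ℂ E]
  [NormedAddCommGroup F] [NormedSpace ℂ F]

lemma subset_cls (S : Set E) : S ⊆ cls S := fun _ hx => subset_closure (Submodule.subset_span hx)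

lemma isClosed_cls (S : Set E) : IsClosed (cls S) := isClosed_closure

/-- The closed linear span as a submodule. -/
lemma cls_eq (S : Set E) : cls S = ((Submodule.span ℂ S).topologicalClosure : Set E) := rfl

/-- A linear continuous map sending `S` in a closed subspace sends its closed span there. -/
lemma cls_map_le {S : Set E} (f : E →L[ℂ] F) (T : Submodule ℂ F) (hT : IsClosed (T : Set F))
    (h : ∀ x ∈ S, f x ∈ T) : ∀ x ∈ cls S, f x ∈ T := by
  have h1 : (Submodule.span ℂ S).topologicalClosure ≤ T.comap f.toLinearMap :=
    Submodule.topologicalClosure_minimal _ (Submodule.span_le.2 h) (hT.preimage f.continuous)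
  exact fun x hx => h1 hx

lemma cls_le {S : Set E} (T : Submodule ℂ E) (hT : IsClosed (T : Set E))
    (h : S ⊆ T) : cls S ⊆ T :=
  cls_map_le (ContinuousLinearMap.id ℂ E) T hT h

end ClosedSpan

section StarSpan

variable {E : Type*} [NonUnitalCStarAlgebra E]

/-- The linear span of a set closed under multiplication and involution, as a `*`-algebra. -/
def starSpan (S : Set E) (hmul : ∀ x ∈ S, ∀ y ∈ S, x * y ∈ S) (hstar : ∀ x ∈ S, star x ∈ S) :
    NonUnitalStarSubalgebra ℂ E where
  toSubmodule := Submodule.span ℂ S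
  mul_mem' := by
    intro a b ha hb
    induction ha, hb using Submodule.span_induction₂ with
    | mem_mem x y hx hy => exact Submodule.subset_span (hmul x hx y hy)
    | zero_left y hy => simp
    | zero_right x hx => simp
    | add_left x y z _ _ _ h1 h2 => rw [add_mul]; exact Submodule.add_mem _ h1 h2
    | add_right x y z _ _ _ h1 h2 => rw [mul_add]; exact Submodule.add_mem _ h1 h2
    | smul_left r x y _ _ h => rw [smul_mul_assoc]; exact Submodule.smul_mem _ r h
    | smul_right r x y _ _ h => rw [mul_smul_comm]; exact Submodule.smul_mem _ r h
  star_mem' := by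
    intro a ha
    induction ha using Submodule.span_induction with
    | mem x hx => exact Submodule.subset_span (hstar x hx)
    | zero => simp
    | add x y _ _ h1 h2 => simpa using add_mem h1 h2
    | smul r x _ h => simpa using Submodule.smul_mem _ _ h

/-- The closed linear span of a set closed under multiplication and involution. -/
def starCls (S : Set E) (hmul : ∀ x ∈ S, ∀ y ∈ S, x * y ∈ S) (hstar : ∀ x ∈ S, star x ∈ S) :
    NonUnitalStarSubalgebra ℂ E := (starSpan S hmul hstar).topologicalClosure

lemma coe_starCls (S : Set E) (hmul : ∀ x ∈ S, ∀ y ∈ S, x * y ∈ S)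
    (hstar : ∀ x ∈ S, star x ∈ S) : (starCls S hmul hstar : Set E) = cls S := rfl

/-- Existence of a bounded two-sided approximate unit. -/
lemma exists_approx (E : Type*) [NonUnitalCStarAlgebra E] : ∃ l : Filter E, l.NeBot ∧
    (∀ᶠ e in l, ‖e‖ ≤ 1) ∧ (∀ a, Filter.Tendsto (fun e => e * a) l (nhds a)) ∧
    (∀ a, Filter.Tendsto (fun e => a * e) l (nhds a)) := by
  let _ := CStarAlgebra.spectralOrder E
  let _ := CStarAlgebra.spectralOrderedRing E
  have h := CStarAlgebra.increasingApproximateUnit E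
  exact ⟨_, h.neBot, h.eventually_norm, h.tendsto_mul_right, h.tendsto_mul_left⟩

end StarSpan

section GraphHom

variable {E F : Type*} [NonUnitalCStarAlgebra E] [NonUnitalCStarAlgebra F]

/-- The `*`-homomorphism with a given graph. -/
def graphHom (T : NonUnitalStarSubalgebra ℂ E) (G : NonUnitalStarSubalgebra ℂ (E × F))
    (hex : ∀ x ∈ T, ∃ y, (x, y) ∈ G) (hinj : ∀ y, ((0 : E), y) ∈ G → y = 0) : T →⋆ₙₐ[ℂ] F :=
  have huniq : ∀ {x y y'}, (x, y) ∈ G → (x, y') ∈ G → y = y' := fun {x y y'} h h' => by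
    have := hinj (y - y') (by simpa using sub_mem h h')
    exact sub_eq_zero.1 this
  have hspec := fun x : T => (hex x x.2).choose_spec
  { toFun := fun x => (hex x x.2).choose
    map_smul' := fun c x => huniq (hspec (c • x))
      (by simpa using SMulMemClass.smul_mem (s := G) c (hspec x))
    map_zero' := huniq (hspec 0) (by exact zero_mem G)
    map_add' := fun x y => huniq (hspec (x + y)) (by exact add_mem (hspec x) (hspec y))
    map_mul' := fun x y => huniq (hspec (x * y)) (by exact mul_mem (hspec x) (hspec y))
    map_star' := fun x => huniq (hspec (star x)) (by exact star_mem (hspec x)) }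

lemma graphHom_mem (T : NonUnitalStarSubalgebra ℂ E) (G : NonUnitalStarSubalgebra ℂ (E × F))
    (hex : ∀ x ∈ T, ∃ y, (x, y) ∈ G) (hinj : ∀ y, ((0 : E), y) ∈ G → y = 0) (x : T) :
    ((x : E), graphHom T G hex hinj x) ∈ G := (hex x x.2).choose_spec

lemma graphHom_eq (T : NonUnitalStarSubalgebra ℂ E) (G : NonUnitalStarSubalgebra ℂ (E × F))
    (hex : ∀ x ∈ T, ∃ y, (x, y) ∈ G) (hinj : ∀ y, ((0 : E), y) ∈ G → y = 0) (x : T) (y : F)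
    (h : ((x : E), y) ∈ G) : graphHom T G hex hinj x = y := by
  have := hinj (graphHom T G hex hinj x - y)
    (by simpa using sub_mem (graphHom_mem T G hex hinj x) h)
  exact sub_eq_zero.1 this

/-- If the closed span of a set of pairs has injective first projection, that projection has
closed range. -/
lemma exists_of_mem_cls (S : Set (E × F)) (hmul : ∀ x ∈ S, ∀ y ∈ S, x * y ∈ S)
    (hstar : ∀ x ∈ S, star x ∈ S) (hinj : ∀ y, ((0 : E), y) ∈ starCls S hmul hstar → y = 0)
    (x : E) (hx : x ∈ cls (Prod.fst '' S)) : ∃ y, (x, y) ∈ starCls S hmul hstar := by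
  set G := starCls S hmul hstar with hG
  have : IsClosed (G : Set (E × F)) := isClosed_cls S
  let p : G →⋆ₙₐ[ℂ] E := (NonUnitalStarAlgHom.fst ℂ E F).comp
    (NonUnitalStarSubalgebraClass.subtype G)
  have hp : Function.Injective p := by
    intro a b hab
    have h1 : (a - b : G).1.1 = 0 := by
      have : a.1.1 = b.1.1 := hab
      simp [this]
    have h2 : (a - b : G).1.2 = 0 := hinj _ (by rw [← h1]; exact (a - b).2)
    have : a - b = 0 := Subtype.ext (Prod.ext h1 h2)
    exact sub_eq_zero.1 this
  have hiso : Isometry p := NonUnitalStarAlgHom.isometry p hp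
  have hcl : IsClosed (Set.range p) := hiso.isClosedEmbedding.isClosed_range
  have hle : cls (Prod.fst '' S) ⊆ Set.range p := by
    let R : Submodule ℂ E := (NonUnitalStarAlgHom.range p).toSubmodule
    have hR : (R : Set E) = Set.range p := by
      ext z; exact NonUnitalStarAlgHom.mem_range p
    rw [← hR]
    refine cls_le R (by rw [hR]; exact hcl) ?_
    rintro _ ⟨s, hs, rfl⟩
    rw [hR]
    exact ⟨⟨s, subset_cls S hs⟩, rfl⟩
  obtain ⟨g, rfl⟩ := hle hx
  exact ⟨g.1.2, g.2⟩

end GraphHom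

section Algebras

variable {H : Type*} [NormedAddCommGroup H] [InnerProductSpace ℂ H] [CompleteSpace H]
  {K : Type*} [NormedAddCommGroup K] [InnerProductSpace ℂ K] [CompleteSpace K]
  {L : Type*} [NormedAddCommGroup L] [InnerProductSpace ℂ L] [CompleteSpace L]

/-- A C⋆-algebra `A ⊆ B(H)` of operators acting non-degenerately on the Hilbert space `H`. -/
structure CStarOp (H : Type*) [NormedAddCommGroup H] [InnerProductSpace ℂ H]
    [CompleteSpace H] where
  /-- The underlying `*`-algebra of operators. -/
  alg : NonUnitalStarSubalgebra ℂ (H →L[ℂ] H)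
  isClosed : IsClosed (alg : Set (H →L[ℂ] H))
  nondeg : cls {v : H | ∃ a ∈ alg, ∃ x, v = a x} = Set.univ

namespace CStarOp

instance (A : CStarOp H) : IsClosed (A.alg : Set (H →L[ℂ] H)) := A.isClosed

lemma eq_zero_of_mul (A : CStarOp H) (n : H →L[ℂ] H) (h : ∀ a ∈ A.alg, n * a = 0) : n = 0 := by
  ext v
  have hv : v ∈ cls {v : H | ∃ a ∈ A.alg, ∃ x, v = a x} := by rw [A.nondeg]; trivial
  refine cls_map_le n ⊥ (by simp) ?_ v hv
  rintro _ ⟨a, ha, x, rfl⟩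
  have := congrArg (fun f => f x) (h a ha)
  simpa using this

/-- The multiplier algebra `M(A) = {m ∈ B(H) : mA ⊆ A, Am ⊆ A}`. -/
def mult (A : CStarOp H) : StarSubalgebra ℂ (H →L[ℂ] H) where
  carrier := {m | ∀ a ∈ A.alg, m * a ∈ A.alg ∧ a * m ∈ A.alg}
  mul_mem' {m n} hm hn a ha := by
    refine ⟨?_, ?_⟩
    · rw [mul_assoc]; exact (hm _ (hn a ha).1).1
    · rw [← mul_assoc]; exact (hn _ (hm a ha).2).2
  one_mem' a ha := by simpa using ha
  add_mem' {m n} hm hn a ha := by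
    refine ⟨?_, ?_⟩
    · rw [add_mul]; exact add_mem (hm a ha).1 (hn a ha).1
    · rw [mul_add]; exact add_mem (hm a ha).2 (hn a ha).2
  zero_mem' a ha := by simp
  algebraMap_mem' r a ha := by
    refine ⟨?_, ?_⟩
    · rw [← Algebra.smul_def]; exact SMulMemClass.smul_mem r ha
    · rw [← Algebra.commutes, ← Algebra.smul_def]; exact SMulMemClass.smul_mem r ha
  star_mem' {m} hm a ha := by
    refine ⟨?_, ?_⟩
    · have := star_mem (hm (star a) (star_mem ha)).2
      simpa using this
    · have := star_mem (hm (star a) (star_mem ha)).1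
      simpa using this

lemma mem_mult {A : CStarOp H} {m : H →L[ℂ] H} :
    m ∈ A.mult ↔ ∀ a ∈ A.alg, m * a ∈ A.alg ∧ a * m ∈ A.alg := Iff.rfl

lemma isClosed_mult (A : CStarOp H) : IsClosed (A.mult : Set (H →L[ℂ] H)) := by
  have : (A.mult : Set (H →L[ℂ] H)) =
      ⋂ a ∈ A.alg, {m | m * a ∈ A.alg} ∩ {m | a * m ∈ A.alg} := by
    ext m; simp [mem_mult]
  rw [this]
  refine isClosed_biInter fun a _ => IsClosed.inter ?_ ?_
  · exact A.isClosed.preimage (continuous_mul_const a)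
  · exact A.isClosed.preimage (continuous_const_mul a)

instance (A : CStarOp H) : IsClosed (A.mult : Set (H →L[ℂ] H)) := A.isClosed_mult

lemma alg_le_mult (A : CStarOp H) {a : H →L[ℂ] H} (ha : a ∈ A.alg) : a ∈ A.mult :=
  fun _ hb => ⟨mul_mem ha hb, mul_mem hb ha⟩

lemma mem_mult_of_left {A : CStarOp H} {m : H →L[ℂ] H} (h : ∀ a ∈ A.alg, m * a ∈ A.alg)
    (h' : ∀ a ∈ A.alg, star m * a ∈ A.alg) : m ∈ A.mult := fun a ha =>
  ⟨h a ha, by simpa using star_mem (h' (star a) (star_mem ha))⟩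

/-- `A = AA`, as a closed linear span. -/
lemma mem_cls_mul (A : CStarOp H) {a : H →L[ℂ] H} (ha : a ∈ A.alg) :
    a ∈ cls {x | ∃ b ∈ A.alg, ∃ c ∈ A.alg, x = b * c} := by
  obtain ⟨l, hl, -, h, -⟩ := exists_approx A.alg
  have h1 : Filter.Tendsto (fun e : A.alg => ((e : H →L[ℂ] H) * a)) l (nhds a) :=
    (continuous_subtype_val.tendsto _).comp (h ⟨a, ha⟩)
  exact (isClosed_cls _).mem_of_tendsto h1
    (Filter.Eventually.of_forall fun e => subset_cls _ ⟨e, e.2, a, ha, rfl⟩)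

/-- The closed linear span of the operators `a ⊗ b` with `a ∈ A` and `b ∈ B`. -/
def tensorAlg (A : CStarOp H) (B : CStarOp K) :
    NonUnitalStarSubalgebra ℂ (HTensor H K →L[ℂ] HTensor H K) :=
  starCls {x | ∃ a ∈ A.alg, ∃ b ∈ B.alg, x = opT a b}
    (by
      rintro _ ⟨a, ha, b, hb, rfl⟩ _ ⟨a', ha', b', hb', rfl⟩
      exact ⟨_, mul_mem ha ha', _, mul_mem hb hb', opT_mul a a' b b'⟩)
    (by
      rintro _ ⟨a, ha, b, hb, rfl⟩
      exact ⟨_, star_mem ha, _, star_mem hb, star_opT a b⟩)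

lemma opT_mem_tensorAlg {A : CStarOp H} {B : CStarOp K} {a : H →L[ℂ] H} {b : K →L[ℂ] K}
    (ha : a ∈ A.alg) (hb : b ∈ B.alg) : opT a b ∈ tensorAlg A B :=
  subset_cls {x | ∃ a ∈ A.alg, ∃ b ∈ B.alg, x = opT a b} ⟨a, ha, b, hb, rfl⟩

/-- The minimal (spatial) tensor product `A ⊗ B ⊆ B(H ⊗ K)` of C⋆-algebras. -/
def tensor (A : CStarOp H) (B : CStarOp K) : CStarOp (HTensor H K) where
  alg := tensorAlg A B
  isClosed := isClosed_cls _
  nondeg := by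
    set S := {v : HTensor H K | ∃ a ∈ tensorAlg A B, ∃ x, v = a x}
    have h1 : ∀ (x : H) (y : K), tm x y ∈ cls S := by
      intro x y
      have hx : x ∈ cls {v : H | ∃ a ∈ A.alg, ∃ x, v = a x} := by rw [A.nondeg]; trivial
      have hy : y ∈ cls {v : K | ∃ a ∈ B.alg, ∃ x, v = a x} := by rw [B.nondeg]; trivial
      refine cls_map_le (insR y) (Submodule.span ℂ S).topologicalClosure (isClosed_cls S) ?_ x hx
      rintro _ ⟨a, ha, x, rfl⟩
      refine cls_map_le (insL (a x)) (Submodule.span ℂ S).topologicalClosure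
        (isClosed_cls S) ?_ y hy
      rintro _ ⟨b, hb, y, rfl⟩
      exact subset_cls S ⟨opT a b, opT_mem_tensorAlg ha hb, tm x y, by simp⟩
    rw [Set.eq_univ_iff_forall]
    intro v
    have hv : v ∈ cls {v : HTensor H K | ∃ x y, v = tm x y} := by
      have := span_tm_dense (H := H) (K := K)
      unfold cls; rw [this]; trivial
    refine cls_le (Submodule.span ℂ S).topologicalClosure (isClosed_cls S) ?_ hv
    rintro _ ⟨x, y, rfl⟩
    exact h1 x y

lemma coe_tensor (A : CStarOp H) (B : CStarOp K) :
    ((A.tensor B).alg : Set (HTensor H K →L[ℂ] HTensor H K)) =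
      cls {x | ∃ a ∈ A.alg, ∃ b ∈ B.alg, x = opT a b} := rfl

lemma opT_mem {A : CStarOp H} {B : CStarOp K} {a : H →L[ℂ] H} {b : K →L[ℂ] K}
    (ha : a ∈ A.alg) (hb : b ∈ B.alg) : opT a b ∈ (A.tensor B).alg :=
  opT_mem_tensorAlg ha hb

end CStarOp

/-- A morphism from `A` to `C`: a `*`-homomorphism `φ : A → M(C)` with `φ(A)C = C`. -/
structure Mor (A : CStarOp H) (C : CStarOp L) where
  /-- The underlying `*`-homomorphism. -/
  hom : A.alg →⋆ₙₐ[ℂ] C.mult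
  nondeg : cls {x : L →L[ℂ] L | ∃ a : A.alg, ∃ c ∈ C.alg, x = hom a * c} = C.alg

namespace Mor

variable {A : CStarOp H} {C : CStarOp L}

instance : CoeFun (Mor A C) (fun _ => A.alg → C.mult) := ⟨fun φ => φ.hom⟩

lemma norm_le (φ : Mor A C) (a : A.alg) : ‖((φ a : C.mult) : L →L[ℂ] L)‖ ≤ ‖(a : H →L[ℂ] H)‖ :=
  NonUnitalStarAlgHom.norm_apply_le φ.hom a

/-- Vectors `φ(a)v` span a dense subspace. -/
lemma dense (φ : Mor A C) (w : L) :
    w ∈ cls {v : L | ∃ (a : A.alg) (x : L), v = (φ a : L →L[ℂ] L) x} := by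
  set S := {v : L | ∃ (a : A.alg) (x : L), v = (φ a : L →L[ℂ] L) x}
  have hw : w ∈ cls {v : L | ∃ a ∈ C.alg, ∃ x, v = a x} := by rw [C.nondeg]; trivial
  refine cls_le (Submodule.span ℂ S).topologicalClosure (isClosed_cls S) ?_ hw
  rintro _ ⟨c, hc, x, rfl⟩
  have hc' : c ∈ cls {x : L →L[ℂ] L | ∃ a : A.alg, ∃ c ∈ C.alg, x = φ.hom a * c} := by
    rw [φ.nondeg]; exact hc
  refine cls_map_le (ContinuousLinearMap.apply ℂ L x) (Submodule.span ℂ S).topologicalClosure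
    (isClosed_cls S) ?_ c hc'
  rintro _ ⟨a, c, -, rfl⟩
  exact subset_cls S ⟨a, c x, rfl⟩

lemma eq_of_mul (φ : Mor A C) {n n' : L →L[ℂ] L}
    (h : ∀ a : A.alg, n * (φ a : L →L[ℂ] L) = n' * (φ a : L →L[ℂ] L)) : n = n' := by
  ext w
  have : (n - n') w ∈ (⊥ : Submodule ℂ L) := by
    refine cls_map_le (n - n') ⊥ (by simp) ?_ w (φ.dense w)
    rintro _ ⟨a, x, rfl⟩
    have := congrArg (fun f => f x) (h a)
    simpa [sub_eq_zero] using this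
  simpa [sub_eq_zero] using this

/-- The product `ma` for a multiplier `m`, as an element of the algebra. -/
def mulL (A : CStarOp H) (m : A.mult) (a : A.alg) : A.alg :=
  ⟨(m : H →L[ℂ] H) * a, (m.2 a a.2).1⟩

/-- Existence of the extension of a morphism to multipliers. -/
lemma exists_ext (φ : Mor A C) (m : A.mult) : ∃ n ∈ C.mult,
    ∀ a : A.alg, n * (φ a : L →L[ℂ] L) = (φ (mulL A m a) : L →L[ℂ] L) := by
  have key : ∀ m : A.mult, ∃ n : L →L[ℂ] L,
      ∀ a : A.alg, n * (φ a : L →L[ℂ] L) = (φ (mulL A m a) : L →L[ℂ] L) := by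
    intro m
    let V : (A.alg × L →₀ ℂ) →ₗ[ℂ] L :=
      Finsupp.linearCombination ℂ fun p : A.alg × L => (φ p.1 : L →L[ℂ] L) p.2
    let Vm : (A.alg × L →₀ ℂ) →ₗ[ℂ] L :=
      Finsupp.linearCombination ℂ fun p : A.alg × L => (φ (mulL A m p.1) : L →L[ℂ] L) p.2
    have hV : ∀ a x c, V (Finsupp.single (a, x) c) = c • (φ a : L →L[ℂ] L) x :=
      fun a x c => Finsupp.linearCombination_single ℂ c (a, x)
    have hVm : ∀ a x c, Vm (Finsupp.single (a, x) c) = c • (φ (mulL A m a) : L →L[ℂ] L) x :=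
      fun a x c => Finsupp.linearCombination_single ℂ c (a, x)
    have hd : DenseRange V := by
      intro w
      have : cls {v : L | ∃ (a : A.alg) (x : L), v = (φ a : L →L[ℂ] L) x} ⊆
          ((LinearMap.range V).topologicalClosure : Set L) := by
        refine cls_le _ (Submodule.isClosed_topologicalClosure _) ?_
        rintro _ ⟨a, x, rfl⟩
        exact subset_closure ⟨Finsupp.single (a, x) 1, by rw [hV, one_smul]⟩
      exact this (φ.dense w)
    obtain ⟨l, hl, hb, h1, -⟩ := exists_approx A.alg
    have hlim : ∀ t, Filter.Tendsto (fun e => (φ (mulL A m e) : L →L[ℂ] L) (V t)) l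
        (nhds (Vm t)) := by
      intro t
      induction t using Finsupp.induction_linear with
      | zero => simp
      | add s t hs ht => simpa using hs.add ht
      | single p c =>
        obtain ⟨a, x⟩ := p
        simp_rw [hV, hVm, map_smul]
        refine Filter.Tendsto.const_smul ?_ c
        have e1 : ∀ e : A.alg, (φ (mulL A m e) : L →L[ℂ] L) ((φ a : L →L[ℂ] L) x) =
            (φ (mulL A m (e * a)) : L →L[ℂ] L) x := by
          intro e
          have : mulL A m (e * a) = mulL A m e * a := Subtype.ext (mul_assoc _ _ _).symm
          rw [this, map_mul]; rfl
        simp_rw [e1]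
        have hc : Continuous fun b : A.alg => (φ (mulL A m b) : L →L[ℂ] L) x := by
          have c1 : Continuous fun b : A.alg => mulL A m b :=
            Continuous.subtype_mk ((continuous_const_mul _).comp continuous_subtype_val) _
          have c2 : Continuous φ.hom :=
            AddMonoidHomClass.continuous_of_bound φ.hom 1 fun b => by
              rw [one_mul]; exact φ.norm_le b
          exact (ContinuousLinearMap.apply ℂ L x).continuous.comp
            (continuous_subtype_val.comp (c2.comp c1))
        exact (hc.tendsto a).comp (h1 a)
    have hbound : ∀ t, ‖Vm t‖ ≤ ‖(m : H →L[ℂ] H)‖ * ‖V t‖ := by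
      intro t
      refine le_of_tendsto (hlim t).norm ?_
      filter_upwards [hb] with e he
      refine (ContinuousLinearMap.le_opNorm _ _).trans ?_
      refine mul_le_mul_of_nonneg_right ?_ (norm_nonneg _)
      refine (φ.norm_le _).trans ((norm_mul_le _ _).trans ?_)
      exact mul_le_of_le_one_right (norm_nonneg _) he
    refine ⟨Vm.extendOfNorm V, fun a => ?_⟩
    ext x
    have := LinearMap.extendOfNorm_eq hd ⟨_, hbound⟩ (Finsupp.single (a, x) 1)
    rw [hV, hVm, one_smul, one_smul] at this
    exact this
  obtain ⟨n, hn⟩ := key m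
  obtain ⟨n', hn'⟩ := key (star m)
  have hleft : ∀ (m : A.mult) (n : L →L[ℂ] L),
      (∀ a : A.alg, n * (φ a : L →L[ℂ] L) = (φ (mulL A m a) : L →L[ℂ] L)) →
      ∀ c ∈ C.alg, n * c ∈ C.alg := by
    intro m n hn c hc
    have hc' : c ∈ cls {x : L →L[ℂ] L | ∃ a : A.alg, ∃ c ∈ C.alg, x = φ.hom a * c} := by
      rw [φ.nondeg]; exact hc
    refine cls_map_le (ContinuousLinearMap.mul ℂ (L →L[ℂ] L) n) C.alg.toSubmodule
      C.isClosed ?_ c hc'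
    rintro _ ⟨a, c, hc, rfl⟩
    change n * ((φ a : L →L[ℂ] L) * c) ∈ C.alg
    rw [← mul_assoc, hn]
    exact ((φ (mulL A m a)).2 c hc).1
  have hstar : star n = n' := by
    refine φ.eq_of_mul fun a => ?_
    have h1 : star (n * (φ a : L →L[ℂ] L)) = star (φ (mulL A m a) : L →L[ℂ] L) := by rw [hn]
    have h2 : ∀ b : A.alg, star (φ b : L →L[ℂ] L) * (star n * (φ a : L →L[ℂ] L)) =
        star (φ b : L →L[ℂ] L) * (n' * (φ a : L →L[ℂ] L)) := by
      intro b
      have e1 : star (φ b : L →L[ℂ] L) * star n = star (φ (mulL A m b) : L →L[ℂ] L) := by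
        rw [← star_mul, hn]
      have e2 : ∀ b : A.alg, star (φ b : L →L[ℂ] L) = (φ (star b) : L →L[ℂ] L) := fun b => by
        rw [map_star]; rfl
      have e3 : star (mulL A m b) * a = star b * mulL A (star m) a := by
        apply Subtype.ext
        simp [mulL, mul_assoc]
      rw [← mul_assoc, e1, hn', e2, e2]
      have := congrArg (fun z => ((φ z : C.mult) : L →L[ℂ] L)) e3
      rw [map_mul, map_mul] at this
      exact this
    have h3 := φ.eq_of_mul (n := star (star n * (φ a : L →L[ℂ] L)))
      (n' := star (n' * (φ a : L →L[ℂ] L))) fun b => by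
        have := congrArg star (h2 b)
        simpa only [star_mul, star_star] using this
    exact star_injective h3
  exact ⟨n, CStarOp.mem_mult_of_left (hleft m n hn)
    (by rw [hstar]; exact hleft (star m) n' hn'), hn⟩

/-- The unique extension of a morphism `φ ∈ Mor(A, C)` to a unital `*`-homomorphism
`M(A) → M(C)`. -/
def ext (φ : Mor A C) : A.mult →⋆ₐ[ℂ] C.mult :=
  have hs := fun m : A.mult => (φ.exists_ext m).choose_spec.2
  { toFun := fun m => ⟨(φ.exists_ext m).choose, (φ.exists_ext m).choose_spec.1⟩
    map_one' := Subtype.ext <| φ.eq_of_mul fun a => by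
      change _ = 1 * (φ a : L →L[ℂ] L)
      have : mulL A 1 a = a := Subtype.ext (one_mul _)
      rw [hs, one_mul, this]
    map_mul' := fun m m' => Subtype.ext <| φ.eq_of_mul fun a => by
      change _ = ((φ.exists_ext m).choose * (φ.exists_ext m').choose) * (φ a : L →L[ℂ] L)
      have : mulL A (m * m') a = mulL A m (mulL A m' a) := Subtype.ext (mul_assoc _ _ _)
      rw [hs, mul_assoc, hs, hs, this]
    map_zero' := Subtype.ext <| φ.eq_of_mul fun a => by
      change _ = 0 * (φ a : L →L[ℂ] L)
      have : mulL A 0 a = 0 := Subtype.ext (zero_mul _)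
      rw [hs, zero_mul, this, map_zero]; rfl
    map_add' := fun m m' => Subtype.ext <| φ.eq_of_mul fun a => by
      change _ = ((φ.exists_ext m).choose + (φ.exists_ext m').choose) * (φ a : L →L[ℂ] L)
      have : mulL A (m + m') a = mulL A m a + mulL A m' a := Subtype.ext (add_mul _ _ _)
      rw [hs, add_mul, hs, hs, this, map_add]; rfl
    commutes' := fun r => Subtype.ext <| φ.eq_of_mul fun a => by
      change _ = (algebraMap ℂ (L →L[ℂ] L) r) * (φ a : L →L[ℂ] L)
      have : mulL A (algebraMap ℂ A.mult r) a = r • a := Subtype.ext (Algebra.smul_def r _).symm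
      rw [hs, this, ← Algebra.smul_def, map_smul]; rfl
    map_star' := fun m => Subtype.ext <| by
      change _ = star (φ.exists_ext m).choose
      refine φ.eq_of_mul fun a => ?_
      rw [hs]
      refine star_injective (φ.eq_of_mul fun b => star_injective ?_)
      have e2 : ∀ b : A.alg, star (φ b : L →L[ℂ] L) = (φ (star b) : L →L[ℂ] L) := fun b => by
        rw [map_star]; rfl
      rw [star_mul, star_mul, star_star, star_star, ← mul_assoc,
        ← star_mul, hs, e2, e2]
      have e3 : star (mulL A m b) * a = star b * mulL A (star m) a := by
        apply Subtype.ext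
        simp [mulL, mul_assoc]
      have := congrArg (fun z => ((φ z : C.mult) : L →L[ℂ] L)) e3
      rw [map_mul, map_mul] at this
      exact this.symm }

lemma ext_mul (φ : Mor A C) (m : A.mult) (a : A.alg) :
    (φ.ext m : L →L[ℂ] L) * (φ a : L →L[ℂ] L) = (φ (mulL A m a) : L →L[ℂ] L) :=
  (φ.exists_ext m).choose_spec.2 a

/-- The extension agrees with the morphism on `A`. -/
lemma ext_coe (φ : Mor A C) (a : A.alg) : φ.ext ⟨a, A.alg_le_mult a.2⟩ = φ a := by
  refine Subtype.ext (φ.eq_of_mul fun b => ?_)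
  rw [ext_mul]
  have : mulL A ⟨a, A.alg_le_mult a.2⟩ b = a * b := rfl
  rw [this, map_mul]; rfl

end Mor

lemma norm_opT_le (a : H →L[ℂ] H) (b : K →L[ℂ] K) : ‖opT a b‖ ≤ ‖a‖ * ‖b‖ := by
  refine (ContinuousLinearMap.opNorm_le_bound _ (by positivity) fun v => ?_)
  refine UniformSpace.Completion.induction_on v (isClosed_le (by fun_prop) (by fun_prop)) fun t => ?_
  rw [opT, ContinuousLinearMap.completion_apply_coe, UniformSpace.Completion.norm_coe,
    UniformSpace.Completion.norm_coe]
  exact (ContinuousLinearMap.le_opNorm _ _).trans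
    (mul_le_mul_of_nonneg_right (TensorProduct.norm_mapL_le a b) (norm_nonneg _))

lemma opT_add_left (a a' : H →L[ℂ] H) (b : K →L[ℂ] K) :
    opT (a + a') b = opT a b + opT a' b :=
  ext_tm fun x y => by simp [tm_add_left]

lemma opT_add_right (a : H →L[ℂ] H) (b b' : K →L[ℂ] K) :
    opT a (b + b') = opT a b + opT a b' :=
  ext_tm fun x y => by simp [tm_add_right]

lemma opT_smul_left (c : ℂ) (a : H →L[ℂ] H) (b : K →L[ℂ] K) : opT (c • a) b = c • opT a b :=
  ext_tm fun x y => by simp [tm_smul_left]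

lemma opT_smul_right (c : ℂ) (a : H →L[ℂ] H) (b : K →L[ℂ] K) : opT a (c • b) = c • opT a b :=
  ext_tm fun x y => by simp [tm_smul_right]

/-- The linear map `b ↦ a ⊗ b`. -/
def opTrLin (a : H →L[ℂ] H) : (K →L[ℂ] K) →ₗ[ℂ] (HTensor H K →L[ℂ] HTensor H K) where
  toFun := fun b => opT a b
  map_add' := opT_add_right a
  map_smul' := fun c b => by rw [opT_smul_right c a b, RingHom.id_apply]

/-- The linear map `a ↦ a ⊗ b`. -/
def opTlLin (b : K →L[ℂ] K) : (H →L[ℂ] H) →ₗ[ℂ] (HTensor H K →L[ℂ] HTensor H K) where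
  toFun := fun a => opT a b
  map_add' := fun a a' => opT_add_left a a' b
  map_smul' := fun c a => by rw [opT_smul_left c a b, RingHom.id_apply]

/-- The bounded linear map `b ↦ a ⊗ b`. -/
def opTr (a : H →L[ℂ] H) : (K →L[ℂ] K) →L[ℂ] (HTensor H K →L[ℂ] HTensor H K) :=
  ⟨opTrLin a, AddMonoidHomClass.continuous_of_bound (opTrLin (K := K) a) ‖a‖
    (fun b => norm_opT_le a b)⟩

/-- The bounded linear map `a ↦ a ⊗ b`. -/
def opTl (b : K →L[ℂ] K) : (H →L[ℂ] H) →L[ℂ] (HTensor H K →L[ℂ] HTensor H K) :=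
  ⟨opTlLin b, AddMonoidHomClass.continuous_of_bound (opTlLin (H := H) b) ‖b‖
    (fun a => (norm_opT_le a b).trans_eq (mul_comm _ _))⟩

/-- If `a` and `b` are in the closed spans of `S` and `T` and all `s ⊗ t` are in the closed span
of `U`, then so is `a ⊗ b`. -/
lemma opT_mem_of_cls {S : Set (H →L[ℂ] H)} {T : Set (K →L[ℂ] K)}
    {U : Set (HTensor H K →L[ℂ] HTensor H K)}
    (h : ∀ s ∈ S, ∀ t ∈ T, opT s t ∈ cls U) {a : H →L[ℂ] H} (ha : a ∈ cls S)
    {b : K →L[ℂ] K} (hb : b ∈ cls T) : opT a b ∈ cls U := by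
  have h1 : ∀ s ∈ S, ∀ t ∈ cls T, opTr s t ∈ (Submodule.span ℂ U).topologicalClosure :=
    fun s hs => cls_map_le (E := K →L[ℂ] K) (F := HTensor H K →L[ℂ] HTensor H K)
      (opTr s) _ (isClosed_cls U) (h s hs)
  have h2 : ∀ s ∈ cls S, opTl b s ∈ (Submodule.span ℂ U).topologicalClosure :=
    cls_map_le (E := H →L[ℂ] H) (F := HTensor H K →L[ℂ] HTensor H K)
      (opTl b) _ (isClosed_cls U) fun s hs => h1 s hs b hb
  exact h2 a ha

/-- The slice `(ω ⊗ id)(X)` for the vector functional `ω = ⟨x, · x'⟩`. -/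
def sliceL (x x' : H) (X : HTensor H K →L[ℂ] HTensor H K) : K →L[ℂ] K :=
  (ContinuousLinearMap.adjoint (insL x)).comp (X.comp (insL x'))

/-- The slice `(id ⊗ ω)(X)` for the vector functional `ω = ⟨y, · y'⟩`. -/
def sliceR (y y' : K) (X : HTensor H K →L[ℂ] HTensor H K) : H →L[ℂ] H :=
  (ContinuousLinearMap.adjoint (insR y)).comp (X.comp (insR y'))

lemma inner_sliceL (x x' : H) (y y' : K) (X : HTensor H K →L[ℂ] HTensor H K) :
    ⟪y, sliceL x x' X y'⟫_ℂ = ⟪tm x y, X (tm x' y')⟫_ℂ := by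
  simp [sliceL, ContinuousLinearMap.adjoint_inner_right]

lemma inner_sliceR (x x' : H) (y y' : K) (X : HTensor H K →L[ℂ] HTensor H K) :
    ⟪x, sliceR y y' X x'⟫_ℂ = ⟪tm x y, X (tm x' y')⟫_ℂ := by
  simp [sliceR, ContinuousLinearMap.adjoint_inner_right]

/-- Slices as bounded linear maps. -/
def sliceLL (x x' : H) : (HTensor H K →L[ℂ] HTensor H K) →L[ℂ] (K →L[ℂ] K) :=
  ((ContinuousLinearMap.compL ℂ K (HTensor H K) K) (ContinuousLinearMap.adjoint (insL x))).comp
    ((ContinuousLinearMap.compL ℂ K (HTensor H K) (HTensor H K)).flip (insL x'))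

/-- Slices as bounded linear maps. -/
def sliceRL (y y' : K) : (HTensor H K →L[ℂ] HTensor H K) →L[ℂ] (H →L[ℂ] H) :=
  ((ContinuousLinearMap.compL ℂ H (HTensor H K) H) (ContinuousLinearMap.adjoint (insR y))).comp
    ((ContinuousLinearMap.compL ℂ H (HTensor H K) (HTensor H K)).flip (insR y'))

lemma sliceLL_apply (x x' : H) (X : HTensor H K →L[ℂ] HTensor H K) :
    sliceLL x x' X = sliceL x x' X := rfl

lemma sliceRL_apply (y y' : K) (X : HTensor H K →L[ℂ] HTensor H K) :
    sliceRL y y' X = sliceR y y' X := rfl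

lemma sliceL_opT (x x' : H) (a : H →L[ℂ] H) (b : K →L[ℂ] K) :
    sliceL x x' (opT a b) = ⟪x, a x'⟫_ℂ • b := by
  ext y'
  refine ext_inner_left ℂ fun y => ?_
  rw [inner_sliceL]
  simp [inner_smul_right]

lemma sliceR_opT (y y' : K) (a : H →L[ℂ] H) (b : K →L[ℂ] K) :
    sliceR y y' (opT a b) = ⟪y, b y'⟫_ℂ • a := by
  ext x'
  refine ext_inner_left ℂ fun x => ?_
  rw [inner_sliceR]
  simp [inner_smul_right, mul_comm]

lemma eq_zero_of_sliceL (X : HTensor H K →L[ℂ] HTensor H K) (h : ∀ x x', sliceL x x' X = 0) :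
    X = 0 := by
  refine ext_tm fun x' y' => ext_inner_tm fun x y => ?_
  rw [← inner_sliceL, h]; simp

lemma eq_zero_of_sliceR (X : HTensor H K →L[ℂ] HTensor H K) (h : ∀ y y', sliceR y y' X = 0) :
    X = 0 := by
  refine ext_tm fun x' y' => ext_inner_tm fun x y => ?_
  rw [← inner_sliceR, h]; simp

lemma opT_mem_mult {A : CStarOp H} {B : CStarOp K} {m : H →L[ℂ] H} {n : K →L[ℂ] K}
    (hm : m ∈ A.mult) (hn : n ∈ B.mult) : opT m n ∈ (A.tensor B).mult := by
  have key : ∀ {m : H →L[ℂ] H} {n : K →L[ℂ] K}, m ∈ A.mult → n ∈ B.mult →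
      ∀ t ∈ (A.tensor B).alg, opT m n * t ∈ (A.tensor B).alg := by
    intro m n hm hn t ht
    refine cls_map_le (ContinuousLinearMap.mul ℂ (HTensor H K →L[ℂ] HTensor H K) (opT m n))
      (A.tensor B).alg.toSubmodule (A.tensor B).isClosed ?_ t ht
    rintro _ ⟨a, ha, b, hb, rfl⟩
    change opT m n * opT a b ∈ (A.tensor B).alg
    rw [opT_mul]
    exact CStarOp.opT_mem (hm a ha).1 (hn b hb).1
  refine CStarOp.mem_mult_of_left (key hm hn) ?_
  rw [star_opT]
  exact key (star_mem hm) (star_mem hn)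

section HomOfGraph

variable {A : CStarOp H} {C : CStarOp L}

/-- The morphism whose graph is the closed span of a given set of pairs. -/
def morOfGraph (S : Set ((H →L[ℂ] H) × (L →L[ℂ] L)))
    (hmul : ∀ x ∈ S, ∀ y ∈ S, x * y ∈ S) (hstar : ∀ x ∈ S, star x ∈ S)
    (hinj : ∀ y, ((0 : H →L[ℂ] H), y) ∈ starCls S hmul hstar → y = 0)
    (hA : (A.alg : Set (H →L[ℂ] H)) = cls (Prod.fst '' S))
    (hC : ∀ p ∈ S, p.2 ∈ C.mult)
    (hnd : (C.alg : Set (L →L[ℂ] L)) ⊆ cls {x | ∃ p ∈ S, ∃ c ∈ C.alg, x = p.2 * c}) :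
    Mor A C :=
  have hex : ∀ x ∈ A.alg, ∃ y, (x, y) ∈ starCls S hmul hstar := fun x hx =>
    exists_of_mem_cls S hmul hstar hinj x (by rw [← hA]; exact hx)
  let f := graphHom A.alg (starCls S hmul hstar) hex hinj
  have hf : ∀ a, f a ∈ C.mult := fun a =>
    cls_map_le (ContinuousLinearMap.snd ℂ (H →L[ℂ] H) (L →L[ℂ] L))
      (Subalgebra.toSubmodule C.mult.toSubalgebra) C.isClosed_mult hC _
      (graphHom_mem A.alg (starCls S hmul hstar) hex hinj a)
  { hom :=
      { toFun := fun a => ⟨f a, hf a⟩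
        map_smul' := fun c x => Subtype.ext (map_smul f c x)
        map_zero' := Subtype.ext (map_zero f)
        map_add' := fun x y => Subtype.ext (map_add f x y)
        map_mul' := fun x y => Subtype.ext (map_mul f x y)
        map_star' := fun x => Subtype.ext (map_star f x) }
    nondeg := by
      refine Set.Subset.antisymm ?_ ?_
      · refine cls_le C.alg.toSubmodule C.isClosed ?_
        rintro _ ⟨a, c, hc, rfl⟩
        exact (hf a c hc).1
      · refine hnd.trans (cls_le (Submodule.span ℂ _).topologicalClosure (isClosed_cls _) ?_)
        rintro _ ⟨p, hp, c, hc, rfl⟩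
        have hp1 : p.1 ∈ A.alg := by
          have : p.1 ∈ cls (Prod.fst '' S) := subset_cls _ ⟨p, hp, rfl⟩
          rw [← hA] at this; exact this
        have : f ⟨p.1, hp1⟩ = p.2 := graphHom_eq _ _ _ _ _ _ (subset_cls S hp)
        refine subset_cls _ ⟨⟨p.1, hp1⟩, c, hc, ?_⟩
        change _ = f ⟨p.1, hp1⟩ * c
        rw [this] }

lemma morOfGraph_apply (S : Set ((H →L[ℂ] H) × (L →L[ℂ] L)))
    (hmul : ∀ x ∈ S, ∀ y ∈ S, x * y ∈ S) (hstar : ∀ x ∈ S, star x ∈ S)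
    (hinj : ∀ y, ((0 : H →L[ℂ] H), y) ∈ starCls S hmul hstar → y = 0)
    (hA : (A.alg : Set (H →L[ℂ] H)) = cls (Prod.fst '' S))
    (hC : ∀ p ∈ S, p.2 ∈ C.mult)
    (hnd : (C.alg : Set (L →L[ℂ] L)) ⊆ cls {x | ∃ p ∈ S, ∃ c ∈ C.alg, x = p.2 * c})
    (a : A.alg) (y : L →L[ℂ] L) (h : ((a : H →L[ℂ] H), y) ∈ S) :
    (morOfGraph S hmul hstar hinj hA hC hnd a : L →L[ℂ] L) = y :=
  graphHom_eq _ _ _ _ _ _ (subset_cls S h)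

end HomOfGraph

namespace Mor

/-- The graph of a morphism. -/
def graph {B : CStarOp K} {C : CStarOp L} (φ : Mor B C) :
    Submodule ℂ ((K →L[ℂ] K) × (L →L[ℂ] L)) where
  carrier := {p | ∃ b : B.alg, (b : K →L[ℂ] K) = p.1 ∧ (φ b : L →L[ℂ] L) = p.2}
  add_mem' := by
    rintro _ _ ⟨b, h1, h2⟩ ⟨b', h1', h2'⟩
    refine ⟨b + b', ?_, ?_⟩
    · rw [Prod.fst_add, ← h1, ← h1']; rfl
    · rw [map_add, Prod.snd_add, ← h2, ← h2']; rfl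
  zero_mem' := ⟨0, rfl, by rw [map_zero]; rfl⟩
  smul_mem' := by
    rintro c _ ⟨b, h1, h2⟩
    refine ⟨c • b, ?_, ?_⟩
    · rw [Prod.smul_fst, ← h1]; rfl
    · rw [map_smul, Prod.smul_snd, ← h2]; rfl

lemma isClosed_graph {B : CStarOp K} {C : CStarOp L} (φ : Mor B C) :
    IsClosed (φ.graph : Set ((K →L[ℂ] K) × (L →L[ℂ] L))) := by
  have hc : Continuous φ.hom :=
    AddMonoidHomClass.continuous_of_bound φ.hom 1 fun b => by rw [one_mul]; exact φ.norm_le b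
  have hiso : Isometry fun b : B.alg => ((b : K →L[ℂ] K), (φ b : L →L[ℂ] L)) := by
    refine AddMonoidHomClass.isometry_of_norm
      (AddMonoidHom.prod (AddSubmonoidClass.subtype B.alg)
        ((AddSubmonoidClass.subtype C.mult).comp (φ.hom : B.alg →+ C.mult))) fun b => ?_
    exact max_eq_left (φ.norm_le b)
  have hE : (φ.graph : Set ((K →L[ℂ] K) × (L →L[ℂ] L))) =
      Set.range fun b : B.alg => ((b : K →L[ℂ] K), (φ b : L →L[ℂ] L)) := by
    ext p
    constructor
    · rintro ⟨b, h1, h2⟩; exact ⟨b, Prod.ext h1 h2⟩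
    · rintro ⟨b, rfl⟩; exact ⟨b, rfl, rfl⟩
  rw [hE]
  exact hiso.isClosedEmbedding.isClosed_range

/-- Pairs `(a ⊗ b, a ⊗ φ(b))`. -/
def graphR (A : CStarOp H) {B : CStarOp K} {C : CStarOp L} (φ : Mor B C) :
    Set ((HTensor H K →L[ℂ] HTensor H K) × (HTensor H L →L[ℂ] HTensor H L)) :=
  {p | ∃ (a : A.alg) (b : B.alg), p = (opT (a : H →L[ℂ] H) (b : K →L[ℂ] K),
    opT (a : H →L[ℂ] H) (φ b : L →L[ℂ] L))}

/-- Pairs `(b ⊗ a, φ(b) ⊗ a)`. -/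
def graphL {B : CStarOp K} {C : CStarOp L} (φ : Mor B C) (A : CStarOp H) :
    Set ((HTensor K H →L[ℂ] HTensor K H) × (HTensor L H →L[ℂ] HTensor L H)) :=
  {p | ∃ (b : B.alg) (a : A.alg), p = (opT (b : K →L[ℂ] K) (a : H →L[ℂ] H),
    opT (φ b : L →L[ℂ] L) (a : H →L[ℂ] H))}

/-- Slicing in the first leg intertwines `id ⊗ φ` and `φ`. -/
lemma slice_graphR (A : CStarOp H) {B : CStarOp K} {C : CStarOp L} (φ : Mor B C) (x x' : H)
    (p : (HTensor H K →L[ℂ] HTensor H K) × (HTensor H L →L[ℂ] HTensor H L))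
    (hp : p ∈ cls (graphR A φ)) : ∃ b : B.alg, (b : K →L[ℂ] K) = sliceL x x' p.1 ∧
      (φ b : L →L[ℂ] L) = sliceL x x' p.2 := by
  let f : ((HTensor H K →L[ℂ] HTensor H K) × (HTensor H L →L[ℂ] HTensor H L)) →L[ℂ]
    ((K →L[ℂ] K) × (L →L[ℂ] L)) := (sliceLL x x').prodMap (sliceLL x x')
  exact cls_map_le f φ.graph φ.isClosed_graph
    (by
      rintro _ ⟨a, b, rfl⟩
      refine ⟨⟪x, (a : H →L[ℂ] H) x'⟫_ℂ • b, ?_, ?_⟩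
      · exact (sliceL_opT x x' (a : H →L[ℂ] H) (b : K →L[ℂ] K)).symm
      · rw [map_smul]
        exact (sliceL_opT x x' (a : H →L[ℂ] H) (φ b : L →L[ℂ] L)).symm) p hp

/-- The morphism `id ⊗ φ ∈ Mor(A ⊗ B, A ⊗ C)` with `(id ⊗ φ)(a ⊗ b) = a ⊗ φ(b)`. -/
def idTensor (A : CStarOp H) {B : CStarOp K} {C : CStarOp L} (φ : Mor B C) :
    Mor (A.tensor B) (A.tensor C) :=
  morOfGraph (graphR A φ)
    (by
      rintro _ ⟨a, b, rfl⟩ _ ⟨a', b', rfl⟩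
      refine ⟨a * a', b * b', ?_⟩
      rw [Prod.mk_mul_mk, opT_mul, opT_mul, map_mul]; rfl)
    (by
      rintro _ ⟨a, b, rfl⟩
      refine ⟨star a, star b, ?_⟩
      rw [Prod.star_def, map_star]
      exact Prod.ext (star_opT _ _) (star_opT _ _))
    (by
      intro Y hY
      refine eq_zero_of_sliceL Y fun x x' => ?_
      obtain ⟨b, hb1, hb2⟩ := slice_graphR A φ x x' _ hY
      have hb : b = 0 := Subtype.ext (hb1.trans (map_zero (sliceLL x x')))
      rw [hb, map_zero] at hb2
      exact hb2.symm)
    (by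
      change cls _ = _
      congr 1
      ext X
      constructor
      · rintro ⟨a, ha, b, hb, rfl⟩
        exact ⟨_, ⟨⟨a, ha⟩, ⟨b, hb⟩, rfl⟩, rfl⟩
      · rintro ⟨_, ⟨a, b, rfl⟩, rfl⟩
        exact ⟨a, a.2, b, b.2, rfl⟩)
    (by
      rintro _ ⟨a, b, rfl⟩
      exact opT_mem_mult (A.alg_le_mult a.2) (φ b).2)
    (by
      refine cls_le (Submodule.span ℂ _).topologicalClosure (isClosed_cls _) ?_
      rintro _ ⟨a, ha, c, hc, rfl⟩
      have hc' : c ∈ cls {x : L →L[ℂ] L | ∃ a : B.alg, ∃ c ∈ C.alg, x = φ.hom a * c} := by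
        rw [φ.nondeg]; exact hc
      refine opT_mem_of_cls ?_ (A.mem_cls_mul ha) hc'
      rintro _ ⟨a, ha, a', ha', rfl⟩ _ ⟨b, c, hc, rfl⟩
      exact subset_cls _ ⟨_, ⟨⟨a, ha⟩, b, rfl⟩, opT a' c, CStarOp.opT_mem ha' hc,
        (opT_mul _ _ _ _).symm⟩)

lemma idTensor_opT (A : CStarOp H) {B : CStarOp K} {C : CStarOp L} (φ : Mor B C)
    (a : A.alg) (b : B.alg) :
    (idTensor A φ ⟨opT (a : H →L[ℂ] H) (b : K →L[ℂ] K), CStarOp.opT_mem a.2 b.2⟩ :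
      HTensor H L →L[ℂ] HTensor H L) = opT (a : H →L[ℂ] H) (φ b : L →L[ℂ] L) :=
  morOfGraph_apply _ _ _ _ _ _ _ _ _ ⟨a, b, rfl⟩

/-- Slicing in the second leg intertwines `φ ⊗ id` and `φ`. -/
lemma slice_graphL {B : CStarOp K} {C : CStarOp L} (φ : Mor B C) (A : CStarOp H) (x x' : H)
    (p : (HTensor K H →L[ℂ] HTensor K H) × (HTensor L H →L[ℂ] HTensor L H))
    (hp : p ∈ cls (graphL φ A)) : ∃ b : B.alg, (b : K →L[ℂ] K) = sliceR x x' p.1 ∧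
      (φ b : L →L[ℂ] L) = sliceR x x' p.2 := by
  let f : ((HTensor K H →L[ℂ] HTensor K H) × (HTensor L H →L[ℂ] HTensor L H)) →L[ℂ]
    ((K →L[ℂ] K) × (L →L[ℂ] L)) := (sliceRL x x').prodMap (sliceRL x x')
  exact cls_map_le f φ.graph φ.isClosed_graph
    (by
      rintro _ ⟨b, a, rfl⟩
      refine ⟨⟪x, (a : H →L[ℂ] H) x'⟫_ℂ • b, ?_, ?_⟩
      · exact (sliceR_opT x x' (b : K →L[ℂ] K) (a : H →L[ℂ] H)).symm
      · rw [map_smul]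
        exact (sliceR_opT x x' (φ b : L →L[ℂ] L) (a : H →L[ℂ] H)).symm) p hp

/-- The morphism `φ ⊗ id ∈ Mor(B ⊗ A, C ⊗ A)` with `(φ ⊗ id)(b ⊗ a) = φ(b) ⊗ a`. -/
def tensorId {B : CStarOp K} {C : CStarOp L} (φ : Mor B C) (A : CStarOp H) :
    Mor (B.tensor A) (C.tensor A) :=
  morOfGraph (graphL φ A)
    (by
      rintro _ ⟨b, a, rfl⟩ _ ⟨b', a', rfl⟩
      refine ⟨b * b', a * a', ?_⟩
      rw [Prod.mk_mul_mk, opT_mul, opT_mul, map_mul]; rfl)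
    (by
      rintro _ ⟨b, a, rfl⟩
      refine ⟨star b, star a, ?_⟩
      rw [Prod.star_def, map_star]
      exact Prod.ext (star_opT _ _) (star_opT _ _))
    (by
      intro Y hY
      refine eq_zero_of_sliceR Y fun x x' => ?_
      obtain ⟨b, hb1, hb2⟩ := slice_graphL φ A x x' _ hY
      have hb : b = 0 := Subtype.ext (hb1.trans (map_zero (sliceRL x x')))
      rw [hb, map_zero] at hb2
      exact hb2.symm)
    (by
      change cls _ = _
      congr 1
      ext X
      constructor
      · rintro ⟨b, hb, a, ha, rfl⟩
        exact ⟨_, ⟨⟨b, hb⟩, ⟨a, ha⟩, rfl⟩, rfl⟩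
      · rintro ⟨_, ⟨b, a, rfl⟩, rfl⟩
        exact ⟨b, b.2, a, a.2, rfl⟩)
    (by
      rintro _ ⟨b, a, rfl⟩
      exact opT_mem_mult (φ b).2 (A.alg_le_mult a.2))
    (by
      refine cls_le (Submodule.span ℂ _).topologicalClosure (isClosed_cls _) ?_
      rintro _ ⟨c, hc, a, ha, rfl⟩
      have hc' : c ∈ cls {x : L →L[ℂ] L | ∃ a : B.alg, ∃ c ∈ C.alg, x = φ.hom a * c} := by
        rw [φ.nondeg]; exact hc
      refine opT_mem_of_cls ?_ hc' (A.mem_cls_mul ha)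
      rintro _ ⟨b, c, hc, rfl⟩ _ ⟨a, ha, a', ha', rfl⟩
      exact subset_cls _ ⟨_, ⟨b, ⟨a, ha⟩, rfl⟩, opT c a', CStarOp.opT_mem hc ha',
        (opT_mul _ _ _ _).symm⟩)

lemma tensorId_opT {B : CStarOp K} {C : CStarOp L} (φ : Mor B C) (A : CStarOp H)
    (b : B.alg) (a : A.alg) :
    (tensorId φ A ⟨opT (b : K →L[ℂ] K) (a : H →L[ℂ] H), CStarOp.opT_mem b.2 a.2⟩ :
      HTensor L H →L[ℂ] HTensor L H) = opT (φ b : L →L[ℂ] L) (a : H →L[ℂ] H) :=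
  morOfGraph_apply _ _ _ _ _ _ _ _ _ ⟨b, a, rfl⟩

end Mor

end Algebras

section QuantumGroups

universe u v

variable {H : Type u} [NormedAddCommGroup H] [InnerProductSpace ℂ H] [CompleteSpace H]

/-- The leg `X₁₂` of an operator on `H ⊗ H`. -/
def leg12 (X : HTensor H H →L[ℂ] HTensor H H) :
    HTensor H (HTensor H H) →L[ℂ] HTensor H (HTensor H H) :=
  reassoc (opT X (1 : H →L[ℂ] H))

/-- The leg `X₂₃` of an operator on `H ⊗ H`. -/
def leg23 (X : HTensor H H →L[ℂ] HTensor H H) :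
    HTensor H (HTensor H H) →L[ℂ] HTensor H (HTensor H H) :=
  opT (1 : H →L[ℂ] H) X

/-- The leg `X₁₃` of an operator on `H ⊗ H`. -/
def leg13 (X : HTensor H H →L[ℂ] HTensor H H) :
    HTensor H (HTensor H H) →L[ℂ] HTensor H (HTensor H H) :=
  leg23 (flipH H H) * leg12 X * leg23 (flipH H H)

/-- Multiplicative unitaries: unitary operators `W` on `H ⊗ H` satisfying the pentagon equation
`W₂₃ W₁₂ = W₁₂ W₁₃ W₂₃`. -/
structure IsMultiplicativeUnitary (W : HTensor H H →L[ℂ] HTensor H H) : Prop where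
  isUnitary : W ∈ unitary (HTensor H H →L[ℂ] HTensor H H)
  pentagon : leg23 W * leg12 W = leg12 W * leg13 W * leg23 W

/-- A positive self-adjoint (in general unbounded) operator with trivial kernel. -/
structure IsPositiveInjective (Q : H →ₗ.[ℂ] H) : Prop where
  selfAdjoint : IsSelfAdjoint Q
  nonneg : ∀ x : Q.domain, 0 ≤ (⟪(x : H), Q x⟫_ℂ).re
  ker : ∀ x : Q.domain, Q x = 0 → x = 0

/-- The graph of the tensor product `P ⊗ Q` of closed operators, that is, of the closure of the
algebraic tensor product. -/
def tensorGraph (P Q : H →ₗ.[ℂ] H) : Set (HTensor H H × HTensor H H) :=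
  cls {p | ∃ (x : P.domain) (y : Q.domain), p = (tm (x : H) (y : H), tm (P x) (Q y))}

/-- Modular multiplicative unitaries: there are positive self-adjoint operators `P` and `Q` with
trivial kernel and a unitary `W'` on `H̄ ⊗ H`, where `J : H → H̄` is the complex conjugate Hilbert
space, such that `W (P ⊗ Q) W* = P ⊗ Q` and
`⟨x ⊗ u, W (z ⊗ y)⟩ = ⟨J z ⊗ Q u, W' (J x ⊗ Q⁻¹ y)⟩` for `u` in the domain of `Q` and `y = Q v` in
the domain of `Q⁻¹`. The manageable ones are those where `P = Q` is possible. -/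
structure IsModular (W : HTensor H H →L[ℂ] HTensor H H) : Prop
    extends IsMultiplicativeUnitary W where
  modular : ∃ (P Q : H →ₗ.[ℂ] H) (Hbar : Type u) (_ : NormedAddCommGroup Hbar)
    (_ : InnerProductSpace ℂ Hbar) (_ : CompleteSpace Hbar) (J : H ≃ₗᵢ⋆[ℂ] Hbar)
    (W' : HTensor Hbar H →L[ℂ] HTensor Hbar H),
    IsPositiveInjective P ∧ IsPositiveInjective Q ∧
    W' ∈ unitary (HTensor Hbar H →L[ℂ] HTensor Hbar H) ∧
    (∀ p : HTensor H H × HTensor H H,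
      p ∈ tensorGraph P Q ↔ (W p.1, W p.2) ∈ tensorGraph P Q) ∧
    ∀ (x z : H) (u v : Q.domain),
      ⟪tm x (u : H), W (tm z (Q v))⟫_ℂ = ⟪tm (J z) (Q u), W' (tm (J x) (v : H))⟫_ℂ

/-- A locally compact quantum group `G = (A, Δ)` and its dual `Ĝ = (Â, Δ̂)`, constructed from a
modular multiplicative unitary `W` on `H ⊗ H`. The C⋆-algebras `A` and `Â` are the norm closures of
the sets of slices of `W`, the comultiplications are `Δ(a) = W (a ⊗ 1) W*` and
`Δ̂(a) = Σ W* (1 ⊗ a) W Σ`, with `Σ` the flip, and `W` is (the image in `B(H ⊗ H)` of) the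
bicharacter in `M(Â ⊗ A)` describing the duality. -/
structure QuantumGroup (H : Type u) [NormedAddCommGroup H] [InnerProductSpace ℂ H]
    [CompleteSpace H] where
  /-- The multiplicative unitary. -/
  W : HTensor H H →L[ℂ] HTensor H H
  isModular : IsModular W
  /-- The C⋆-algebra `A` of `G`. -/
  A : CStarOp H
  A_eq : (A.alg : Set (H →L[ℂ] H)) = cls {a | ∃ x x' : H, a = sliceL x x' W}
  /-- The C⋆-algebra `Â` of `Ĝ`. -/
  Ahat : CStarOp H
  Ahat_eq : (Ahat.alg : Set (H →L[ℂ] H)) = cls {a | ∃ y y' : H, a = sliceR y y' W}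
  /-- The comultiplication of `G`. -/
  Δ : Mor A (A.tensor A)
  Δ_eq : ∀ a : A.alg, (Δ a : HTensor H H →L[ℂ] HTensor H H) = W * opT (a : H →L[ℂ] H) 1 * star W
  /-- The comultiplication of `Ĝ`. -/
  Δhat : Mor Ahat (Ahat.tensor Ahat)
  Δhat_eq : ∀ a : Ahat.alg, (Δhat a : HTensor H H →L[ℂ] HTensor H H) =
    flipH H H * (star W * opT 1 (a : H →L[ℂ] H) * W) * flipH H H
  W_mem : W ∈ (Ahat.tensor A).mult

namespace QuantumGroup

variable (G : QuantumGroup H) {K : Type v} [NormedAddCommGroup K] [InnerProductSpace ℂ K]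
  [CompleteSpace K]

/-- A continuous left action of `Ĝ` on `B`: an injective morphism `β ∈ Mor(B, Â ⊗ B)` with
`(id ⊗ β)β = (Δ̂ ⊗ id)β` and `(Â ⊗ 1)β(B) = Â ⊗ B`. -/
structure IsContinuousLeftAction (B : CStarOp K) (β : Mor B (G.Ahat.tensor B)) : Prop where
  injective : Function.Injective β.hom
  coassoc : ∀ b : B.alg,
    (((Mor.idTensor G.Ahat β).ext (β b) : (G.Ahat.tensor (G.Ahat.tensor B)).mult) :
      HTensor H (HTensor H K) →L[ℂ] HTensor H (HTensor H K)) =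
    reassoc (((Mor.tensorId G.Δhat B).ext (β b) : ((G.Ahat.tensor G.Ahat).tensor B).mult) :
      HTensor (HTensor H H) K →L[ℂ] HTensor (HTensor H H) K)
  podles : cls {x : HTensor H K →L[ℂ] HTensor H K | ∃ a ∈ G.Ahat.alg, ∃ b : B.alg,
    x = opT a 1 * (β b : HTensor H K →L[ℂ] HTensor H K)} = (G.Ahat.tensor B).alg

/-- A `G`-product `(B, β, ψ)`: a continuous left action `β` of `Ĝ` on `B` and an injective
morphism `ψ ∈ Mor(Â, B)` with `β ψ = (id ⊗ ψ)Δ̂`. -/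
structure IsGProduct (B : CStarOp K) (β : Mor B (G.Ahat.tensor B)) (ψ : Mor G.Ahat B) : Prop where
  action : G.IsContinuousLeftAction B β
  injective : Function.Injective ψ.hom
  comm : ∀ a : G.Ahat.alg, β.ext (ψ a) = (Mor.idTensor G.Ahat ψ).ext (G.Δhat a)

/-- A unitary 2-cocycle: a unitary `Ω ∈ M(Â ⊗ Â)` with
`(Ω ⊗ 1)(Δ̂ ⊗ id)(Ω) = (1 ⊗ Ω)(id ⊗ Δ̂)(Ω)`. -/
structure IsUnitaryTwoCocycle (Ω : (G.Ahat.tensor G.Ahat).mult) : Prop where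
  isUnitary : Ω ∈ unitary (G.Ahat.tensor G.Ahat).mult
  cocycle :
    reassoc (opT (Ω : HTensor H H →L[ℂ] HTensor H H) (1 : H →L[ℂ] H) *
      (((Mor.tensorId G.Δhat G.Ahat).ext Ω : ((G.Ahat.tensor G.Ahat).tensor G.Ahat).mult) :
        HTensor (HTensor H H) H →L[ℂ] HTensor (HTensor H H) H)) =
    opT (1 : H →L[ℂ] H) (Ω : HTensor H H →L[ℂ] HTensor H H) *
      (((Mor.idTensor G.Ahat G.Δhat).ext Ω : (G.Ahat.tensor (G.Ahat.tensor G.Ahat)).mult) :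
        HTensor H (HTensor H H) →L[ℂ] HTensor H (HTensor H H))

/-- The Drinfeld twist induced by `Ω` is trivial: `Ω* Δ̂(a) Ω = Δ̂(a)` for all `a ∈ Â`. -/
def HasTrivialTwist (Ω : (G.Ahat.tensor G.Ahat).mult) : Prop :=
  ∀ a : G.Ahat.alg, star Ω * G.Δhat a * Ω = G.Δhat a

end QuantumGroup

end QuantumGroups

end QG

end

/-! ### Morphisms: density arguments, extension to multipliers, composition and tensoring -/

noncomputable section

namespace QG

variable {H : Type*} [NormedAddCommGroup H] [InnerProductSpace ℂ H] [CompleteSpace H]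
  {K : Type*} [NormedAddCommGroup K] [InnerProductSpace ℂ K] [CompleteSpace K]
  {L : Type*} [NormedAddCommGroup L] [InnerProductSpace ℂ L] [CompleteSpace L]
  {M : Type*} [NormedAddCommGroup M] [InnerProductSpace ℂ M] [CompleteSpace M]

/-! Write U for Ω_{1ψ} = (id ⊗ ψ)(Ω), a unitary multiplier of Â ⊗ B. Then β^Ω = U* β(·) U is an
injective morphism because β is one, and β^Ω ψ(a) = (id ⊗ ψ)(Ω* Δ̂(a) Ω) = (id ⊗ ψ)Δ̂(a) by
triviality of the twist. Coassociativity and the Podleś condition need more.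

Coassociativity (`IsGProduct.coassoc_conj`). Since βψ = (id ⊗ ψ)Δ̂, the element (id ⊗ β)(U) is the
image of (id ⊗ Δ̂)(Ω) under id ⊗ id ⊗ ψ. The trivial twist makes Ω₂₃ commute with (id ⊗ Δ̂)(Ω), so
the cocycle identity becomes (id ⊗ Δ̂)(Ω) Ω₂₃ = Ω₁₂ (Δ̂ ⊗ id)(Ω). Applying id ⊗ id ⊗ ψ gives (id ⊗
β)(U) U₂₃ = Ω₁₂ (Δ̂ ⊗ id)(U). Hence (id ⊗ β^Ω)β^Ω(b) is (id ⊗ β)β(b) = (Δ̂ ⊗ id)β(b) conjugated by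
Ω₁₂ (Δ̂ ⊗ id)(U). The factor Ω₁₂ disappears, because by the trivial twist it commutes with the range
of Δ̂ ⊗ id.

Podleś condition (`IsGProduct.podles_conj`). The unitary U need not commute with Â ⊗ 1, so the
condition is not inherited by mere conjugation. Instead, write B = ψ(Â)B and use (Â ⊗ 1)Δ̂(Â) = Â ⊗
Â (`QuantumGroup.cancellation`): (Â ⊗ 1)β^Ω(B) = (id ⊗ ψ)((Â ⊗ 1)Δ̂(Â)) β^Ω(B) = (id ⊗ ψ)((Â ⊗ Â)Ω*)
β(B)U = (1 ⊗ ψ(Â))(Â ⊗ 1)β(B)U = (Â ⊗ B)U = Â ⊗ B. The cancellation property itself is obtained from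
the pentagon equation and W ∈ M(Â ⊗ A). -/

lemma coe_mult_mul {A : CStarOp H} (m n : A.mult) :
    ((m * n : A.mult) : H →L[ℂ] H) = (m : H →L[ℂ] H) * (n : H →L[ℂ] H) := rfl

namespace CStarOp

/-- An element of `A`, regarded as a multiplier. -/
def toMult (A : CStarOp H) (a : A.alg) : A.mult := ⟨a, A.alg_le_mult a.2⟩

/-- The multiplier `m ⊗ n`. -/
def multT (A : CStarOp H) (B : CStarOp K) (m : A.mult) (n : B.mult) : (A.tensor B).mult :=
  ⟨opT (m : H →L[ℂ] H) (n : K →L[ℂ] K), opT_mem_mult m.2 n.2⟩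

/-- The element `a ⊗ b`. -/
def algT (A : CStarOp H) (B : CStarOp K) (a : A.alg) (b : B.alg) : (A.tensor B).alg :=
  ⟨opT (a : H →L[ℂ] H) (b : K →L[ℂ] K), opT_mem a.2 b.2⟩

end CStarOp

namespace Mor

variable {A : CStarOp H} {B : CStarOp K} {C : CStarOp L} {D : CStarOp M}

lemma hom_ext {φ χ : Mor A C} (h : ∀ a, (φ a : L →L[ℂ] L) = χ a) : φ = χ := by
  cases φ; cases χ
  congr 1
  exact NonUnitalStarAlgHom.ext fun a => Subtype.ext (h a)

lemma continuous_hom (φ : Mor A C) : Continuous fun a : A.alg => (φ a : L →L[ℂ] L) :=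
  continuous_subtype_val.comp
    (AddMonoidHomClass.continuous_of_bound φ.hom 1 fun b => by rw [one_mul]; exact φ.norm_le b)

/-- The underlying map of a morphism, as a bounded linear map to operators. -/
def toCLM (φ : Mor A C) : A.alg →L[ℂ] (L →L[ℂ] L) where
  toFun a := φ a
  map_add' a b := by rw [map_add]; rfl
  map_smul' c a := by rw [map_smul]; rfl
  cont := φ.continuous_hom

/-- A closed linear property of the elements of `A` follows from a generating set. -/
lemma induction_cls {S : Set (H →L[ℂ] H)} (hS : (A.alg : Set (H →L[ℂ] H)) = cls S)
    {E : Type*} [NormedAddCommGroup E] [NormedSpace ℂ E]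
    (f : A.alg →L[ℂ] E) (T : Submodule ℂ E) (hT : IsClosed (T : Set E))
    (h : ∀ a : A.alg, (a : H →L[ℂ] H) ∈ S → f a ∈ T) (a : A.alg) : f a ∈ T := by
  have hSA : ∀ x ∈ Submodule.span ℂ S, x ∈ A.alg := fun x hx => by
    have : x ∈ (A.alg : Set (H →L[ℂ] H)) := by rw [hS]; exact subset_closure hx
    exact this
  have hspan : ∀ (x : H →L[ℂ] H) (hx : x ∈ Submodule.span ℂ S), f ⟨x, hSA x hx⟩ ∈ T := by
    intro x hx
    induction hx using Submodule.span_induction with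
    | mem x hx => exact h ⟨x, _⟩ hx
    | zero =>
      have : f ⟨0, hSA 0 (Submodule.zero_mem _)⟩ = 0 := map_zero f
      rw [this]; exact T.zero_mem
    | add x y hx hy h1 h2 =>
      have : f ⟨x + y, hSA _ (Submodule.add_mem _ hx hy)⟩ = f ⟨x, hSA x hx⟩ + f ⟨y, hSA y hy⟩ :=
        map_add f (⟨x, hSA x hx⟩ : A.alg) ⟨y, hSA y hy⟩
      rw [this]; exact T.add_mem h1 h2
    | smul c x hx h1 =>
      have : f ⟨c • x, hSA _ (Submodule.smul_mem _ c hx)⟩ = c • f ⟨x, hSA x hx⟩ :=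
        map_smul f c (⟨x, hSA x hx⟩ : A.alg)
      rw [this]; exact T.smul_mem c h1
  have ha : (a : H →L[ℂ] H) ∈ closure (Submodule.span ℂ S : Set (H →L[ℂ] H)) := by
    have : (a : H →L[ℂ] H) ∈ (A.alg : Set (H →L[ℂ] H)) := a.2
    rwa [hS] at this
  -- The map `f` is only defined on `A`, so the density of the span has to be moved from B(H) to the
  -- subspace topology of `A`.
  have ha' : a ∈ closure {x : A.alg | (x : H →L[ℂ] H) ∈ Submodule.span ℂ S} := by
    rw [closure_subtype]
    refine closure_mono ?_ ha
    intro x hx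
    exact ⟨⟨x, hSA x hx⟩, hx, rfl⟩
  exact closure_minimal (s := {x : A.alg | (x : H →L[ℂ] H) ∈ Submodule.span ℂ S})
    (t := {x | f x ∈ T}) (fun x hx => hspan x hx) (hT.preimage f.continuous) ha'

lemma eq_of_cls {S : Set (H →L[ℂ] H)} (hS : (A.alg : Set (H →L[ℂ] H)) = cls S)
    {E : Type*} [NormedAddCommGroup E] [NormedSpace ℂ E] {f g : A.alg →L[ℂ] E}
    (h : ∀ a : A.alg, (a : H →L[ℂ] H) ∈ S → f a = g a) (a : A.alg) : f a = g a := by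
  have := induction_cls hS (f - g) ⊥ (by simp) (fun a ha => by simp [h a ha]) a
  simpa [sub_eq_zero] using this

/-- Bounded linear maps on `A ⊗ B` are determined by elementary tensors. -/
lemma eq_of_algT {E : Type*} [NormedAddCommGroup E] [NormedSpace ℂ E]
    {f g : (A.tensor B).alg →L[ℂ] E}
    (h : ∀ a b, f (A.algT B a b) = g (A.algT B a b)) : f = g :=
  ContinuousLinearMap.ext <| eq_of_cls (CStarOp.coe_tensor A B) <| by
    rintro ⟨x, hx⟩ ⟨a, ha, b, hb, rfl⟩
    exact h ⟨a, ha⟩ ⟨b, hb⟩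

lemma hom_ext_tensor {φ χ : Mor (A.tensor B) C}
    (h : ∀ a b, (φ (A.algT B a b) : L →L[ℂ] L) = χ (A.algT B a b)) : φ = χ :=
  hom_ext fun x => congrArg (fun f => f x) (eq_of_algT (f := φ.toCLM) (g := χ.toCLM) h)

/-- Uniqueness of the extension: the vectors φ(a)v span a dense subspace, so an operator is known
once its products with φ(A) are. This is how extensions are computed throughout. -/
lemma ext_eq_of_mul (φ : Mor A C) (m : A.mult) {n : L →L[ℂ] L}
    (h : ∀ a : A.alg, n * (φ a : L →L[ℂ] L) = φ (mulL A m a)) :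
    (φ.ext m : L →L[ℂ] L) = n :=
  φ.eq_of_mul fun a => by rw [φ.ext_mul, h]

lemma ext_mul_hom (φ : Mor A C) (m : A.mult) (a : A.alg) : φ.ext m * φ a = φ (mulL A m a) :=
  Subtype.ext (φ.ext_mul m a)

lemma ext_toMult (φ : Mor A C) (a : A.alg) : φ.ext (A.toMult a) = φ a := φ.ext_coe a

/-- The composition of morphisms. -/
def comp (χ : Mor C D) (φ : Mor A C) : Mor A D where
  hom := ((χ.ext : C.mult →⋆ₙₐ[ℂ] D.mult)).comp φ.hom
  nondeg := by
    refine Set.Subset.antisymm ?_ ?_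
    · refine cls_le D.alg.toSubmodule D.isClosed ?_
      rintro _ ⟨a, d, hd, rfl⟩
      exact ((χ.ext (φ a)).2 d hd).1
    · have hD : (D.alg : Set (M →L[ℂ] M)) ⊆
          cls {x | ∃ c : C.alg, ∃ d ∈ D.alg, x = χ.hom c * d} := by rw [χ.nondeg]
      refine hD.trans (cls_le (Submodule.span ℂ _).topologicalClosure (isClosed_cls _) ?_)
      rintro _ ⟨c, d, hd, rfl⟩
      refine induction_cls φ.nondeg.symm
        ((((ContinuousLinearMap.mul ℂ (M →L[ℂ] M)).flip d).comp χ.toCLM)) _ (isClosed_cls _) ?_ c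
      rintro ⟨x, hx⟩ ⟨a, c, hc, rfl⟩
      -- With D = χ(C)D and C = φ(A)C, the generator χ(φ(a)c)d is regrouped as χ(φ(a)) · (χ(c)d),
      -- whose second factor lies in D.
      refine subset_cls _ ⟨a, (χ ⟨c, hc⟩ : M →L[ℂ] M) * d, ((χ ⟨c, hc⟩).2 d hd).1, ?_⟩
      change (χ (mulL C (φ a) ⟨c, hc⟩) : M →L[ℂ] M) * d = (χ.ext (φ a) : M →L[ℂ] M) * _
      rw [← mul_assoc, χ.ext_mul]

lemma comp_apply (χ : Mor C D) (φ : Mor A C) (a : A.alg) : χ.comp φ a = χ.ext (φ a) := rfl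

lemma comp_ext (χ : Mor C D) (φ : Mor A C) (m : A.mult) :
    (χ.comp φ).ext m = χ.ext (φ.ext m) :=
  Subtype.ext <| ext_eq_of_mul _ m fun a => by
    rw [comp_apply, comp_apply, ← ext_mul_hom, map_mul]; rfl

/-- An operator commuting with the image of `A` commutes with the image of `M(A)`. -/
lemma ext_commute (φ : Mor A C) {v : L →L[ℂ] L}
    (h : ∀ a, v * (φ a : L →L[ℂ] L) = φ a * v) (m : A.mult) :
    v * (φ.ext m : L →L[ℂ] L) = φ.ext m * v :=
  φ.eq_of_mul fun a => by
    rw [mul_assoc, φ.ext_mul, h, mul_assoc, h, ← mul_assoc, φ.ext_mul]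

/-- Multiplying by m ⊗ n keeps elementary tensors elementary, and these span a dense subspace of A ⊗
B. Testing on them therefore identifies the extension at m ⊗ n. -/
lemma ext_multT (φ : Mor (A.tensor B) C) (m : A.mult) (n : B.mult) {y : L →L[ℂ] L}
    (h : ∀ a b, y * (φ (A.algT B a b) : L →L[ℂ] L) = φ (A.algT B (mulL A m a) (mulL B n b))) :
    (φ.ext (A.multT B m n) : L →L[ℂ] L) = y := by
  refine φ.ext_eq_of_mul _ fun x => ?_
  rw [← φ.ext_mul]
  let f (z : L →L[ℂ] L) : (A.tensor B).alg →L[ℂ] (L →L[ℂ] L) :=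
    (ContinuousLinearMap.mul ℂ (L →L[ℂ] L) z).comp φ.toCLM
  have : f y = f (φ.ext (A.multT B m n)) := eq_of_algT fun a b => by
    change y * (φ (A.algT B a b) : L →L[ℂ] L) = φ.ext (A.multT B m n) * φ (A.algT B a b)
    have e : mulL (A.tensor B) (A.multT B m n) (A.algT B a b) =
        A.algT B (mulL A m a) (mulL B n b) := Subtype.ext (opT_mul _ _ _ _)
    rw [h, φ.ext_mul, e]
  exact congrArg (fun f => f x) this

lemma idTensor_algT (A : CStarOp H) (φ : Mor B C) (a : A.alg) (b : B.alg) :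
    (idTensor A φ (A.algT B a b) : HTensor H L →L[ℂ] HTensor H L) =
      opT (a : H →L[ℂ] H) (φ b : L →L[ℂ] L) := idTensor_opT A φ a b

lemma tensorId_algT (φ : Mor B C) (A : CStarOp H) (b : B.alg) (a : A.alg) :
    (tensorId φ A (B.algT A b a) : HTensor L H →L[ℂ] HTensor L H) =
      opT (φ b : L →L[ℂ] L) (a : H →L[ℂ] H) := tensorId_opT φ A b a

lemma idTensor_ext_multT (A : CStarOp H) (φ : Mor B C) (m : A.mult) (n : B.mult) :
    (idTensor A φ).ext (A.multT B m n) = A.multT C m (φ.ext n) :=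
  Subtype.ext <| ext_multT _ _ _ fun a b => by
    rw [idTensor_algT, idTensor_algT, ← φ.ext_mul]
    exact opT_mul _ _ _ _

lemma tensorId_ext_multT (φ : Mor B C) (A : CStarOp H) (n : B.mult) (m : A.mult) :
    (tensorId φ A).ext (B.multT A n m) = C.multT A (φ.ext n) m :=
  Subtype.ext <| ext_multT _ _ _ fun a b => by
    rw [tensorId_algT, tensorId_algT, ← φ.ext_mul]
    exact opT_mul _ _ _ _

lemma idTensor_comp (A : CStarOp H) (χ : Mor C D) (φ : Mor B C) :
    idTensor A (χ.comp φ) = (idTensor A χ).comp (idTensor A φ) :=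
  hom_ext_tensor fun a b => by
    have : idTensor A φ (A.algT B a b) = A.multT C (A.toMult a) (φ b) :=
      Subtype.ext (idTensor_algT A φ a b)
    rw [comp_apply, this, idTensor_ext_multT, idTensor_algT]
    rfl

/-- Morphisms acting on different legs commute. It is used with φ = Δ̂ and χ = ψ. -/
lemma tensorId_comp_idTensor {N : Type*} [NormedAddCommGroup N] [InnerProductSpace ℂ N]
    [CompleteSpace N] {E : CStarOp N} (φ : Mor A C) (χ : Mor B E) :
    (tensorId φ E).comp (idTensor A χ) = (idTensor C χ).comp (tensorId φ B) :=
  hom_ext_tensor fun a b => by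
    have h1 : idTensor A χ (A.algT B a b) = A.multT E (A.toMult a) (χ b) :=
      Subtype.ext (idTensor_algT A χ a b)
    have h2 : tensorId φ B (A.algT B a b) = C.multT B (φ a) (B.toMult b) :=
      Subtype.ext (tensorId_algT φ B a b)
    rw [comp_apply, comp_apply, h1, h2, idTensor_ext_multT, tensorId_ext_multT, ext_toMult,
      ext_toMult]

end Mor

end QG

/-! ### The associativity isomorphism as a morphism -/

namespace QG

variable {H : Type*} [NormedAddCommGroup H] [InnerProductSpace ℂ H] [CompleteSpace H]
  {K : Type*} [NormedAddCommGroup K] [InnerProductSpace ℂ K] [CompleteSpace K]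
  {L : Type*} [NormedAddCommGroup L] [InnerProductSpace ℂ L] [CompleteSpace L]
  {M : Type*} [NormedAddCommGroup M] [InnerProductSpace ℂ M] [CompleteSpace M]

lemma cls_le_cls {E : Type*} [NormedAddCommGroup E] [NormedSpace ℂ E] {S T : Set E}
    (h : S ⊆ cls T) : cls S ⊆ cls T :=
  cls_le (Submodule.span ℂ T).topologicalClosure (isClosed_cls T) h

lemma cls_map_le_cls {E F : Type*} [NormedAddCommGroup E] [NormedSpace ℂ E]
    [NormedAddCommGroup F] [NormedSpace ℂ F] {S : Set E} {T : Set F} (f : E →L[ℂ] F)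
    (h : ∀ x ∈ S, f x ∈ cls T) : ∀ x ∈ cls S, f x ∈ cls T :=
  cls_map_le f (Submodule.span ℂ T).topologicalClosure (isClosed_cls T) h

/-- The morphism given by a `*`-homomorphism mapping `A` to a dense subspace of `C`. -/
def Mor.ofHom {A : CStarOp H} {C : CStarOp L} (f : (H →L[ℂ] H) →⋆ₙₐ[ℂ] (L →L[ℂ] L))
    (hf : ∀ a ∈ A.alg, f a ∈ C.alg) (hC : (C.alg : Set (L →L[ℂ] L)) ⊆ cls (f '' A.alg)) :
    Mor A C where
  hom :=
    { toFun := fun a => ⟨f a, C.alg_le_mult (hf a a.2)⟩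
      map_smul' := fun c x => Subtype.ext (map_smul f c _)
      map_zero' := Subtype.ext (map_zero f)
      map_add' := fun x y => Subtype.ext (map_add f _ _)
      map_mul' := fun x y => Subtype.ext (map_mul f _ _)
      map_star' := fun x => Subtype.ext (map_star f _) }
  nondeg := by
    refine Set.Subset.antisymm ?_ ?_
    · refine cls_le C.alg.toSubmodule C.isClosed ?_
      rintro _ ⟨x, y, hy, rfl⟩
      exact C.alg.mul_mem' (hf x x.2) hy
    · intro c hc
      refine cls_le_cls ?_ (C.mem_cls_mul hc)
      rintro _ ⟨b, hb, c, hc, rfl⟩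
      refine cls_map_le_cls ((ContinuousLinearMap.mul ℂ (L →L[ℂ] L)).flip c) ?_ b (hC hb)
      rintro _ ⟨a, ha, rfl⟩
      exact subset_cls _ ⟨⟨a, ha⟩, c, hc, rfl⟩

lemma Mor.hom_ext_cls {A : CStarOp H} {C : CStarOp L} {S : Set (H →L[ℂ] H)}
    (hS : (A.alg : Set (H →L[ℂ] H)) = cls S) {φ χ : Mor A C}
    (h : ∀ a : A.alg, (a : H →L[ℂ] H) ∈ S → (φ a : L →L[ℂ] L) = χ a) : φ = χ :=
  Mor.hom_ext <| Mor.eq_of_cls hS (f := φ.toCLM) (g := χ.toCLM) h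

section Assoc

lemma reassoc_mul (X Y : HTensor (HTensor H K) L →L[ℂ] HTensor (HTensor H K) L) :
    reassoc (X * Y) = reassoc X * reassoc Y := by
  ext v; simp [reassoc]

lemma reassoc_star (X : HTensor (HTensor H K) L →L[ℂ] HTensor (HTensor H K) L) :
    reassoc (star X) = star (reassoc X) := by
  rw [ContinuousLinearMap.star_eq_adjoint, ContinuousLinearMap.star_eq_adjoint,
    ContinuousLinearMap.eq_adjoint_iff]
  intro v w
  obtain ⟨v, rfl⟩ := (assocH H K L).surjective v
  obtain ⟨w, rfl⟩ := (assocH H K L).surjective w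
  simp [reassoc, ContinuousLinearMap.adjoint_inner_left]

/-- `reassoc` as a bounded linear map. -/
def reassocCLM : (HTensor (HTensor H K) L →L[ℂ] HTensor (HTensor H K) L) →L[ℂ]
    (HTensor H (HTensor K L) →L[ℂ] HTensor H (HTensor K L)) :=
  (ContinuousLinearMap.compL ℂ (HTensor H (HTensor K L)) (HTensor (HTensor H K) L)
    (HTensor H (HTensor K L))
    (assocH H K L).toContinuousLinearEquiv.toContinuousLinearMap).comp
  ((ContinuousLinearMap.compL ℂ (HTensor H (HTensor K L)) (HTensor (HTensor H K) L)
    (HTensor (HTensor H K) L)).flip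
    (assocH H K L).symm.toContinuousLinearEquiv.toContinuousLinearMap)

lemma reassocCLM_apply (X : HTensor (HTensor H K) L →L[ℂ] HTensor (HTensor H K) L) :
    reassocCLM X = reassoc X := rfl

variable (A : CStarOp H) (B : CStarOp K) (C : CStarOp L)

lemma tensor_tensor_eq_cls : (((A.tensor B).tensor C).alg : Set _) =
    cls {x | ∃ a ∈ A.alg, ∃ b ∈ B.alg, ∃ c ∈ C.alg, x = opT (opT a b) c} := by
  refine Set.Subset.antisymm ?_ ?_
  · refine cls_le_cls ?_
    rintro _ ⟨t, ht, c, hc, rfl⟩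
    refine opT_mem_of_cls (S := {x | ∃ a ∈ A.alg, ∃ b ∈ B.alg, x = opT a b}) (T := C.alg) ?_ ht
      (subset_cls _ hc)
    rintro _ ⟨a, ha, b, hb, rfl⟩ c hc
    exact subset_cls _ ⟨a, ha, b, hb, c, hc, rfl⟩
  · refine cls_le ((A.tensor B).tensor C).alg.toSubmodule ((A.tensor B).tensor C).isClosed ?_
    rintro _ ⟨a, ha, b, hb, c, hc, rfl⟩
    exact CStarOp.opT_mem (CStarOp.opT_mem ha hb) hc

lemma tensor_tensor_eq_cls' : ((A.tensor (B.tensor C)).alg : Set _) =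
    cls {x | ∃ a ∈ A.alg, ∃ b ∈ B.alg, ∃ c ∈ C.alg, x = opT a (opT b c)} := by
  refine Set.Subset.antisymm ?_ ?_
  · refine cls_le_cls ?_
    rintro _ ⟨a, ha, t, ht, rfl⟩
    refine opT_mem_of_cls (T := {x | ∃ a ∈ B.alg, ∃ b ∈ C.alg, x = opT a b}) (S := A.alg) ?_
      (subset_cls _ ha) ht
    rintro a ha _ ⟨b, hb, c, hc, rfl⟩
    exact subset_cls _ ⟨a, ha, b, hb, c, hc, rfl⟩
  · refine cls_le (A.tensor (B.tensor C)).alg.toSubmodule (A.tensor (B.tensor C)).isClosed ?_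
    rintro _ ⟨a, ha, b, hb, c, hc, rfl⟩
    exact CStarOp.opT_mem ha (CStarOp.opT_mem hb hc)

lemma reassoc_mem {x} (hx : x ∈ ((A.tensor B).tensor C).alg) :
    reassoc x ∈ (A.tensor (B.tensor C)).alg := by
  have hx' : x ∈ (((A.tensor B).tensor C).alg : Set _) := hx
  rw [tensor_tensor_eq_cls] at hx'
  refine cls_map_le (reassocCLM (H := H) (K := K) (L := L)) (A.tensor (B.tensor C)).alg.toSubmodule
    (A.tensor (B.tensor C)).isClosed ?_ x hx'
  rintro _ ⟨a, ha, b, hb, c, hc, rfl⟩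
  rw [reassocCLM_apply, reassoc_opT]
  exact CStarOp.opT_mem ha (CStarOp.opT_mem hb hc)

variable (H K L) in
/-- `reassoc` as a `*`-homomorphism. -/
def reassocHom : (HTensor (HTensor H K) L →L[ℂ] HTensor (HTensor H K) L) →⋆ₙₐ[ℂ]
    (HTensor H (HTensor K L) →L[ℂ] HTensor H (HTensor K L)) where
  toFun X := reassoc X
  map_smul' c X := map_smul (reassocCLM (H := H) (K := K) (L := L)) c X
  map_zero' := map_zero (reassocCLM (H := H) (K := K) (L := L))
  map_add' X Y := map_add (reassocCLM (H := H) (K := K) (L := L)) X Y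
  map_mul' X Y := reassoc_mul X Y
  map_star' X := reassoc_star X

lemma reassoc_image_dense : ((A.tensor (B.tensor C)).alg : Set _) ⊆
    cls (reassocHom H K L '' ((A.tensor B).tensor C).alg) := by
  rw [tensor_tensor_eq_cls']
  refine cls_le_cls ?_
  rintro _ ⟨a, ha, b, hb, c, hc, rfl⟩
  exact subset_cls _ ⟨opT (opT a b) c, CStarOp.opT_mem (CStarOp.opT_mem ha hb) hc,
    reassoc_opT a b c⟩

/-- The associativity isomorphism `(A ⊗ B) ⊗ C → A ⊗ (B ⊗ C)`, as a morphism. -/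
def assocMor : Mor ((A.tensor B).tensor C) (A.tensor (B.tensor C)) :=
  Mor.ofHom (reassocHom H K L) (fun _ hx => reassoc_mem A B C hx) (reassoc_image_dense A B C)

/-- Since `reassoc` is multiplicative on all bounded operators, it has the property characterising
the extension. The `reassoc` in the definitions of actions and cocycles can thus be treated as a
morphism and composed with others. -/
lemma assocMor_ext (m : ((A.tensor B).tensor C).mult) :
    ((assocMor A B C).ext m : HTensor H (HTensor K L) →L[ℂ] HTensor H (HTensor K L)) =
      reassoc m :=
  Mor.ext_eq_of_mul _ _ fun _ => (reassoc_mul _ _).symm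

lemma Mor.hom_ext_tensor_tensor {D : CStarOp M} {φ χ : Mor ((A.tensor B).tensor C) D}
    (h : ∀ a b c, (φ ((A.tensor B).algT C (A.algT B a b) c) : M →L[ℂ] M) =
      χ ((A.tensor B).algT C (A.algT B a b) c)) : φ = χ := by
  refine Mor.hom_ext_cls (tensor_tensor_eq_cls A B C) ?_
  rintro ⟨_, _⟩ ⟨a, ha, b, hb, c, hc, rfl⟩
  exact h ⟨a, ha⟩ ⟨b, hb⟩ ⟨c, hc⟩

lemma assocMor_algT (a : A.alg) (b : B.alg) (c : C.alg) :
    assocMor A B C ((A.tensor B).algT C (A.algT B a b) c) =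
      (A.tensor (B.tensor C)).toMult (A.algT (B.tensor C) a (B.algT C b c)) :=
  Subtype.ext (reassoc_opT (a : H →L[ℂ] H) (b : K →L[ℂ] K) (c : L →L[ℂ] L))

lemma assocMor_ext_multT (a : A.mult) (b : B.mult) (c : C.mult) :
    (assocMor A B C).ext ((A.tensor B).multT C (A.multT B a b) c) =
      A.multT (B.tensor C) a (B.multT C b c) :=
  Subtype.ext ((assocMor_ext A B C _).trans
    (reassoc_opT (a : H →L[ℂ] H) (b : K →L[ℂ] K) (c : L →L[ℂ] L)))

lemma Mor.idTensor_algT' {D : CStarOp M} (φ : Mor B D) (a : A.alg) (b : B.alg) :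
    idTensor A φ (A.algT B a b) = A.multT D (A.toMult a) (φ b) :=
  Subtype.ext (idTensor_algT A φ a b)

/-- Both sides send (a ⊗ b) ⊗ c to a ⊗ (b ⊗ φ(c)). This later allows ψ to be applied in the third
leg before or after rebracketing. -/
lemma assocMor_naturality {D : CStarOp M} (φ : Mor C D) :
    (Mor.idTensor A (Mor.idTensor B φ)).comp (assocMor A B C) =
      (assocMor A B D).comp (Mor.idTensor (A.tensor B) φ) := by
  refine Mor.hom_ext_tensor_tensor A B C fun a b c => congrArg Subtype.val ?_
  have e1 : (Mor.idTensor A (Mor.idTensor B φ)).ext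
      (assocMor A B C ((A.tensor B).algT C (A.algT B a b) c)) =
      A.multT (B.tensor D) (A.toMult a) (B.multT D (B.toMult b) (φ c)) :=
    (congrArg (Mor.idTensor A (Mor.idTensor B φ)).ext (assocMor_algT A B C a b c)).trans
      ((Mor.ext_toMult _ _).trans ((Mor.idTensor_algT' A _ (Mor.idTensor B φ) a _).trans
        (congrArg (A.multT (B.tensor D) (A.toMult a)) (Mor.idTensor_algT' B C φ b c))))
  have e2 : (assocMor A B D).ext
      (Mor.idTensor (A.tensor B) φ ((A.tensor B).algT C (A.algT B a b) c)) =
      A.multT (B.tensor D) (A.toMult a) (B.multT D (B.toMult b) (φ c)) :=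
    (congrArg (assocMor A B D).ext
      (Mor.idTensor_algT' (A.tensor B) C φ (A.algT B a b) c)).trans
      (assocMor_ext_multT A B D (A.toMult a) (B.toMult b) (φ c))
  exact e1.trans e2.symm

end Assoc

end QG

/-! ### Closed spans of operators, and slices of the pentagon equation in the third leg -/

namespace QG

section Operators

variable {H : Type*} [NormedAddCommGroup H] [InnerProductSpace ℂ H] [CompleteSpace H]
  {K : Type*} [NormedAddCommGroup K] [InnerProductSpace ℂ K] [CompleteSpace K]
  {L : Type*} [NormedAddCommGroup L] [InnerProductSpace ℂ L] [CompleteSpace L]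

/-- The bounded linear map `X ↦ P X Q`. -/
def sandwich (P : K →L[ℂ] L) (Q : H →L[ℂ] K) : (K →L[ℂ] K) →L[ℂ] (H →L[ℂ] L) :=
  (ContinuousLinearMap.compL ℂ H K L P).comp ((ContinuousLinearMap.compL ℂ H K K).flip Q)

lemma sandwich_comp_apply (P : K →L[ℂ] L) (R : K →L[ℂ] K) (Q : H →L[ℂ] K) (X : K →L[ℂ] K) :
    sandwich (P.comp R) Q X = P.comp ((R * X).comp Q) := rfl

lemma sandwich_apply_mul (P Q X : H →L[ℂ] H) : sandwich P Q X = P * X * Q := rfl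

lemma opTr_apply (a : H →L[ℂ] H) (b : K →L[ℂ] K) : opTr a b = opT a b := rfl

lemma opTl_apply (b : K →L[ℂ] K) (a : H →L[ℂ] H) : opTl b a = opT a b := rfl

lemma map_mem_cls {S : Set (H →L[ℂ] H)} {T : Set (K →L[ℂ] K)}
    (f : (H →L[ℂ] H) →L[ℂ] (K →L[ℂ] K)) (h : ∀ x ∈ S, f x ∈ cls T) {x : H →L[ℂ] H}
    (hx : x ∈ cls S) : f x ∈ cls T :=
  cls_map_le_cls (E := H →L[ℂ] H) (F := K →L[ℂ] K) f h x hx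

lemma map_mem_alg {S : Set (H →L[ℂ] H)} {C : CStarOp K}
    (f : (H →L[ℂ] H) →L[ℂ] (K →L[ℂ] K)) (h : ∀ x ∈ S, f x ∈ C.alg) {x : H →L[ℂ] H}
    (hx : x ∈ cls S) : f x ∈ C.alg :=
  cls_map_le (E := H →L[ℂ] H) (F := K →L[ℂ] K) f C.alg.toSubmodule C.isClosed h x hx

lemma mem_tensor_iff {A : CStarOp H} {B : CStarOp K} {x : HTensor H K →L[ℂ] HTensor H K} :
    x ∈ (A.tensor B).alg ↔ x ∈ cls {x | ∃ a ∈ A.alg, ∃ b ∈ B.alg, x = opT a b} := Iff.rfl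

lemma map_tensor_mem_cls {A : CStarOp H} {B : CStarOp K} {T : Set (L →L[ℂ] L)}
    (f : (HTensor H K →L[ℂ] HTensor H K) →L[ℂ] (L →L[ℂ] L))
    (h : ∀ a ∈ A.alg, ∀ b ∈ B.alg, f (opT a b) ∈ cls T) {x : HTensor H K →L[ℂ] HTensor H K}
    (hx : x ∈ (A.tensor B).alg) : f x ∈ cls T := by
  refine map_mem_cls f ?_ (mem_tensor_iff.1 hx)
  rintro _ ⟨a, ha, b, hb, rfl⟩
  exact h a ha b hb

lemma map_tensor_mem_alg {A : CStarOp H} {B : CStarOp K} {C : CStarOp L}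
    (f : (HTensor H K →L[ℂ] HTensor H K) →L[ℂ] (L →L[ℂ] L))
    (h : ∀ a ∈ A.alg, ∀ b ∈ B.alg, f (opT a b) ∈ C.alg) {x : HTensor H K →L[ℂ] HTensor H K}
    (hx : x ∈ (A.tensor B).alg) : f x ∈ C.alg := by
  refine map_mem_alg f ?_ (mem_tensor_iff.1 hx)
  rintro _ ⟨a, ha, b, hb, rfl⟩
  exact h a ha b hb

lemma tensor_mem_cls {A : CStarOp H} {B : CStarOp K} {T : Set (HTensor H K →L[ℂ] HTensor H K)}
    (h : ∀ a ∈ A.alg, ∀ b ∈ B.alg, opT a b ∈ cls T) {x : HTensor H K →L[ℂ] HTensor H K}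
    (hx : x ∈ (A.tensor B).alg) : x ∈ cls T :=
  map_tensor_mem_cls (ContinuousLinearMap.id ℂ _) h hx

lemma cls_eq_alg {C : CStarOp L} {T : Set (L →L[ℂ] L)} (h1 : ∀ x ∈ T, x ∈ C.alg)
    (h2 : ∀ x ∈ C.alg, x ∈ cls T) : cls T = C.alg :=
  Set.Subset.antisymm (fun _ hx => map_mem_alg (ContinuousLinearMap.id ℂ _) h1 hx) h2

lemma mem_alg_of_eq {C : CStarOp L} {T : Set (L →L[ℂ] L)} (h : cls T = C.alg) {x : L →L[ℂ] L} :
    x ∈ cls T ↔ x ∈ C.alg := by rw [h]; rfl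

/-- The involution is conjugate linear, so the transport lemmas for bounded linear maps do not apply
and the span induction is repeated. -/
lemma star_mem_cls {S T : Set (L →L[ℂ] L)}
    (h : ∀ x ∈ S, star x ∈ cls T) {x : L →L[ℂ] L} (hx : star x ∈ cls S) : x ∈ cls T := by
  have h1 : ∀ y ∈ Submodule.span ℂ S, star y ∈ (Submodule.span ℂ T).topologicalClosure := by
    intro y hy
    induction hy using Submodule.span_induction with
    | mem y hy => exact h y hy
    | zero => rw [star_zero]; exact Submodule.zero_mem _
    | add y z _ _ hy hz => rw [star_add]; exact Submodule.add_mem _ hy hz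
    | smul c y _ hy => rw [star_smul]; exact Submodule.smul_mem _ _ hy
  have h2 := closure_minimal (t := {y | star y ∈ cls T}) h1
    ((isClosed_cls T).preimage continuous_star) hx
  rwa [Set.mem_ofPred_eq, star_star] at h2

end Operators

section ThirdLeg

variable {H : Type*} [NormedAddCommGroup H] [InnerProductSpace ℂ H] [CompleteSpace H]
  {K : Type*} [NormedAddCommGroup K] [InnerProductSpace ℂ K] [CompleteSpace K]
  {L : Type*} [NormedAddCommGroup L] [InnerProductSpace ℂ L] [CompleteSpace L]

/-- The map `y ↦ insR y` as a bounded linear map. -/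
def insRL : K →L[ℂ] H →L[ℂ] HTensor H K :=
  (ContinuousLinearMap.compL ℂ H (H ⊗[ℂ] K) (HTensor H K)
    (UniformSpace.Completion.toComplL (𝕜 := ℂ) (E := H ⊗[ℂ] K))).comp
    (TensorProduct.mkL ℂ H K).flip

/-- The slice `sliceR y y' X` as a bounded linear map in `y'`. -/
def sliceRVec (y : K) (X : HTensor H K →L[ℂ] HTensor H K) : K →L[ℂ] (H →L[ℂ] H) :=
  (ContinuousLinearMap.compL ℂ H (HTensor H K) H
    ((ContinuousLinearMap.adjoint (insR y)).comp X)).comp insRL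

/-- The operator `x ⊗ z ↦ x ⊗ (z ⊗ y)`. -/
def ins3 (y : L) : HTensor H K →L[ℂ] HTensor H (HTensor K L) :=
  opT (1 : H →L[ℂ] H) (insR y)

@[simp] lemma ins3_tm (y : L) (x : H) (z : K) :
    (ins3 y : HTensor H K →L[ℂ] HTensor H (HTensor K L)) (tm x z) = tm x (tm z y) := by
  simp [ins3]

lemma assocH_tm_right (v : HTensor H K) (y : L) : assocH H K L (tm v y) = ins3 y v := by
  have : ((assocH H K L).toContinuousLinearEquiv.toContinuousLinearMap).comp (insR y) =
      (ins3 y : HTensor H K →L[ℂ] HTensor H (HTensor K L)) :=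
    ext_tm fun x z => by simp
  exact congrArg (fun f => f v) this

lemma leg12_ins3 (X : HTensor H H →L[ℂ] HTensor H H) (y : H) (v : HTensor H H) :
    leg12 X (ins3 y v) = ins3 y (X v) := by
  rw [← assocH_tm_right, ← assocH_tm_right]
  simp [leg12, reassoc]

/-- The operators `ins3` insert a vector in the third leg, so compressing X₂₃ by them slices X in
its second leg and leaves the first leg alone. -/
lemma opT_one_sliceR (X : HTensor K L →L[ℂ] HTensor K L) (y y' : L) :
    opT (1 : H →L[ℂ] H) (sliceR y y' X) =
      (ContinuousLinearMap.adjoint (ins3 y)).comp ((opT (1 : H →L[ℂ] H) X).comp (ins3 y')) := by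
  refine ext_tm fun x' z' => ext_inner_tm fun x z => ?_
  simp [ContinuousLinearMap.adjoint_inner_right, inner_sliceR]

lemma inner_leg23_flip (x y z z' : H) (v : HTensor H H) :
    ⟪tm x (tm z y), leg23 (flipH H H) (ins3 z' v)⟫_ℂ = ⟪z, z'⟫_ℂ * ⟪tm x y, v⟫_ℂ := by
  have : (innerSL ℂ (tm x (tm z y))).comp ((leg23 (flipH H H)).comp (ins3 z')) =
      ⟪z, z'⟫_ℂ • innerSL ℂ (tm x y) := by
    refine ext_tm fun x' y' => ?_
    simp [leg23]
    ring
  exact congrArg (fun f => f v) this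

/-- The operator X₁₃ acts trivially on the second leg, so slicing its third leg leaves the identity
there. The flips in `leg13` are removed by testing on elementary tensors. -/
lemma sliceR_opT_one (X : HTensor H H →L[ℂ] HTensor H H) (y y' : H) :
    (ContinuousLinearMap.adjoint (ins3 y)).comp ((leg13 X).comp (ins3 y')) =
      opT (sliceR y y' X) (1 : H →L[ℂ] H) := by
  refine ext_tm fun x' z' => ext_inner_tm fun x z => ?_
  have h : leg13 X (tm x' (tm z' y')) = leg23 (flipH H H) (ins3 z' (X (tm x' y'))) := by
    rw [← leg12_ins3]
    simp [leg13, leg23]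
  rw [ContinuousLinearMap.comp_apply, ContinuousLinearMap.adjoint_inner_right, ins3_tm,
    ContinuousLinearMap.comp_apply, ins3_tm, h, inner_leg23_flip, opT_tm, inner_tm, inner_sliceR,
    mul_comm]
  rfl

lemma leg12_isometry {W : HTensor H H →L[ℂ] HTensor H H} (hW : star W * W = 1) :
    star (leg12 W) * leg12 W = 1 := by
  rw [leg12, ← reassoc_star, ← reassoc_mul, star_opT, opT_mul, hW, star_one, mul_one,
    opT_one]
  ext v; simp [reassoc]

/-- The pentagon equation, sliced in the third leg. -/
lemma conj_slice {W : HTensor H H →L[ℂ] HTensor H H} (hW : IsMultiplicativeUnitary W) (y y' : H) :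
    star W * opT 1 (sliceR y y' W) * W =
      (ContinuousLinearMap.adjoint (ins3 y)).comp ((leg13 W * leg23 W).comp (ins3 y')) := by
  -- The pentagon equation solved for W₁₃ W₂₃. Since W₁₂ does not act on the third leg, it can then
  -- be pulled out of the slice.
  have h1 : leg13 W * leg23 W = star (leg12 W) * (leg23 W * leg12 W) := by
    rw [hW.pentagon, mul_assoc, ← mul_assoc, leg12_isometry hW.isUnitary.1, one_mul]
  rw [h1, opT_one_sliceR]
  refine ContinuousLinearMap.ext fun v => ext_inner_left ℂ fun w => ?_
  simp only [mul_apply_eq_comp, ContinuousLinearMap.comp_apply,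
    ContinuousLinearMap.star_eq_adjoint, ContinuousLinearMap.adjoint_inner_right, leg12_ins3]
  rfl

/-- The bounded linear map `X ↦ (id ⊗ id ⊗ ω)(W₁₃ X₂₃)`. -/
def slice3 (W : HTensor H H →L[ℂ] HTensor H H) (y y' : H) :
    (HTensor H H →L[ℂ] HTensor H H) →L[ℂ] (HTensor H H →L[ℂ] HTensor H H) :=
  (sandwich ((ContinuousLinearMap.adjoint (ins3 y)).comp (leg13 W)) (ins3 y')).comp
    (opTr (1 : H →L[ℂ] H))

lemma slice3_apply (W X : HTensor H H →L[ℂ] HTensor H H) (y y' : H) :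
    slice3 W y y' X = (ContinuousLinearMap.adjoint (ins3 y)).comp
      ((leg13 W * leg23 X).comp (ins3 y')) := by
  rw [slice3, ContinuousLinearMap.comp_apply, sandwich_comp_apply, opTr_apply, leg23]

lemma leg23_opT_comp_ins3 (c a : H →L[ℂ] H) (y : H) :
    (leg23 (opT c a)).comp (ins3 y) = (ins3 (a y)).comp (opT 1 c) :=
  ext_tm fun x z => by simp [leg23]

/-- Evaluated at c ⊗ a, the map `slice3` gives a generator of Â ⊗ Â; evaluated at W(c ⊗ a), it gives
by `slice3_mul_opT` a generator of the cancellation span. In both cases a is absorbed by the slicing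
vector and c passes to the second leg. -/
lemma slice3_opT (W : HTensor H H →L[ℂ] HTensor H H) (y y' : H) (c a : H →L[ℂ] H) :
    slice3 W y y' (opT c a) = opT (sliceR y (a y') W) c := by
  have h : (leg13 W * leg23 (opT c a)).comp (ins3 y') =
      ((leg13 W).comp (ins3 (a y'))).comp (opT 1 c) := by
    rw [ContinuousLinearMap.comp_assoc, ← leg23_opT_comp_ins3]; rfl
  rw [slice3_apply, h, ← ContinuousLinearMap.comp_assoc, sliceR_opT_one, opT_comp]
  rfl

lemma slice3_mul_opT {W : HTensor H H →L[ℂ] HTensor H H} (hW : IsMultiplicativeUnitary W)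
    (y y' : H) (c a : H →L[ℂ] H) :
    slice3 W y y' (W * opT c a) = star W * opT 1 (sliceR y (a y') W) * W * opT 1 c := by
  have h : (leg13 W * leg23 (W * opT c a)).comp (ins3 y') =
      ((leg13 W * leg23 W).comp (ins3 (a y'))).comp (opT 1 c) := by
    have : leg23 (W * opT c a) = leg23 W * leg23 (opT c a) := by
      simp [leg23, opT_mul]
    rw [ContinuousLinearMap.comp_assoc, ← leg23_opT_comp_ins3, this, ← mul_assoc]; rfl
  rw [slice3_apply, h, conj_slice hW]
  rfl

end ThirdLeg

end QG

/-! ### The cancellation property of the dual comultiplication -/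

namespace QG

section Flip

variable {H : Type*} [NormedAddCommGroup H] [InnerProductSpace ℂ H] [CompleteSpace H]

lemma flipH_mul_flipH : flipH H H * flipH H H = 1 := ext_tm fun x y => by simp

lemma flipH_opT_flipH (a b : H →L[ℂ] H) : flipH H H * opT a b * flipH H H = opT b a :=
  ext_tm fun x y => by simp

/-- Conjugation by the flip, as a bounded linear map. -/
def conjFlip : (HTensor H H →L[ℂ] HTensor H H) →L[ℂ] (HTensor H H →L[ℂ] HTensor H H) :=
  sandwich (flipH H H) (flipH H H)

lemma conjFlip_apply (X : HTensor H H →L[ℂ] HTensor H H) :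
    conjFlip X = flipH H H * X * flipH H H := sandwich_apply_mul _ _ _

lemma conjFlip_mul (X Y : HTensor H H →L[ℂ] HTensor H H) :
    conjFlip (X * Y) = conjFlip X * conjFlip Y := by
  have h : ∀ Z : HTensor H H →L[ℂ] HTensor H H, flipH H H * (flipH H H * Z) = Z := fun Z => by
    rw [← mul_assoc, flipH_mul_flipH, one_mul]
  simp only [conjFlip_apply, mul_assoc, h]

end Flip

namespace QuantumGroup

variable {H : Type*} [NormedAddCommGroup H] [InnerProductSpace ℂ H] [CompleteSpace H]
  (G : QuantumGroup H)

lemma mem_Ahat_iff (s : H →L[ℂ] H) :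
    s ∈ G.Ahat.alg ↔ s ∈ cls {a | ∃ y y' : H, a = sliceR y y' G.W} := by
  rw [← SetLike.mem_coe, G.Ahat_eq]

lemma sliceR_mem (y y' : H) : sliceR y y' G.W ∈ G.Ahat.alg :=
  (G.mem_Ahat_iff _).2 (subset_cls _ ⟨y, y', rfl⟩)

/-- The algebra A acts non-degenerately and slices are linear and continuous in y', so y' may be
taken of the form a y'. The spare factor a makes W(c ⊗ a) available, which lies in Â ⊗ A while W is
only a multiplier. -/
lemma mem_cls_slice {s : H →L[ℂ] H} (hs : s ∈ G.Ahat.alg) :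
    s ∈ cls {s | ∃ y y' : H, ∃ a ∈ G.A.alg, s = sliceR y (a y') G.W} := by
  refine cls_le_cls ?_ ((G.mem_Ahat_iff s).1 hs)
  rintro _ ⟨y, y', rfl⟩
  have hy : y' ∈ cls {v : H | ∃ a ∈ G.A.alg, ∃ x, v = a x} := by rw [G.A.nondeg]; trivial
  refine cls_map_le_cls (sliceRVec y G.W) ?_ y' hy
  rintro _ ⟨a, ha, x, rfl⟩
  exact subset_cls _ ⟨y, x, a, ha, rfl⟩

/-- The cancellation property of `Δ̂`, before the flip. -/
lemma cancellation_aux : cls {x | ∃ s ∈ G.Ahat.alg, ∃ c ∈ G.Ahat.alg,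
    x = star G.W * opT 1 s * G.W * opT 1 c} = (G.Ahat.tensor G.Ahat).alg := by
  have hW := G.isModular.toIsMultiplicativeUnitary
  refine cls_eq_alg ?_ fun x hx => tensor_mem_cls ?_ hx
  · rintro _ ⟨s, hs, c, hc, rfl⟩
    let f : (H →L[ℂ] H) →L[ℂ] (HTensor H H →L[ℂ] HTensor H H) :=
      (sandwich (star G.W) (G.W * opT 1 c)).comp (opTr (1 : H →L[ℂ] H))
    have hf : ∀ s, f s = star G.W * opT 1 s * G.W * opT 1 c := fun s => by
      rw [mul_assoc (star G.W * opT 1 s)]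
      exact sandwich_apply_mul _ _ _
    rw [← hf]
    refine map_mem_alg f ?_ (G.mem_cls_slice hs)
    rintro _ ⟨y, y', a, ha, rfl⟩
    -- As W(c ⊗ a) lies in Â ⊗ A, it is a limit of sums of elementary tensors, and `slice3_opT`
    -- sends each of those into Â ⊗ Â.
    rw [hf, ← slice3_mul_opT hW]
    refine map_tensor_mem_alg (slice3 G.W y y') ?_
      (G.W_mem _ (CStarOp.opT_mem hc ha)).1
    intro c hc a ha
    rw [slice3_opT]
    exact CStarOp.opT_mem (G.sliceR_mem _ _) hc
  · intro s hs c hc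
    rw [← opTl_apply]
    refine map_mem_cls (opTl c) ?_ (G.mem_cls_slice hs)
    rintro _ ⟨y, y', a, ha, rfl⟩
    have hmem : star G.W * opT c a ∈ (G.Ahat.tensor G.A).alg :=
      ((star_mem G.W_mem : star G.W ∈ (G.Ahat.tensor G.A).mult) _ (CStarOp.opT_mem hc ha)).1
    -- Inserting W W* = 1 reverses the argument: W*(c ⊗ a) is approximated by elementary tensors,
    -- and W times such a tensor is sliced by `slice3_mul_opT`.
    have h1 : opT c a = sandwich G.W 1 (star G.W * opT c a) := by
      rw [sandwich_apply_mul, mul_one, ← mul_assoc, hW.isUnitary.2, one_mul]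
    rw [opTl_apply, ← slice3_opT, h1, ← ContinuousLinearMap.comp_apply]
    refine map_tensor_mem_cls _ ?_ hmem
    intro c hc a ha
    refine subset_cls _ ⟨sliceR y (a y') G.W, G.sliceR_mem _ _, c, hc, ?_⟩
    rw [ContinuousLinearMap.comp_apply, sandwich_apply_mul, mul_one, slice3_mul_opT hW]

/-- The flip in the formula for Δ̂ exchanges the legs, so the factor 1 ⊗ c of `cancellation_aux`
becomes c ⊗ 1. -/
lemma Δhat_mul_opT (s : G.Ahat.alg) (c : H →L[ℂ] H) :
    (G.Δhat s : HTensor H H →L[ℂ] HTensor H H) * opT c 1 =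
      conjFlip (star G.W * opT 1 (s : H →L[ℂ] H) * G.W * opT 1 c) := by
  rw [conjFlip_mul, conjFlip_apply, conjFlip_apply, flipH_opT_flipH, G.Δhat_eq]

lemma cancellation_right : cls {x | ∃ s : G.Ahat.alg, ∃ c ∈ G.Ahat.alg,
    x = (G.Δhat s : HTensor H H →L[ℂ] HTensor H H) * opT c 1} = (G.Ahat.tensor G.Ahat).alg := by
  refine cls_eq_alg ?_ fun x hx => tensor_mem_cls ?_ hx
  · rintro _ ⟨s, c, hc, rfl⟩
    rw [G.Δhat_mul_opT]
    have h : star G.W * opT 1 (s : H →L[ℂ] H) * G.W * opT 1 c ∈ (G.Ahat.tensor G.Ahat).alg :=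
      (mem_alg_of_eq G.cancellation_aux).1 (subset_cls _ ⟨s, s.2, c, hc, rfl⟩)
    refine map_tensor_mem_alg conjFlip ?_ h
    intro a ha b hb
    rw [conjFlip_apply, flipH_opT_flipH]
    exact CStarOp.opT_mem hb ha
  · intro a ha b hb
    rw [← flipH_opT_flipH, ← conjFlip_apply]
    refine map_mem_cls conjFlip ?_
      ((mem_alg_of_eq G.cancellation_aux).2 (CStarOp.opT_mem hb ha))
    rintro _ ⟨s, hs, c, hc, rfl⟩
    exact subset_cls _ ⟨⟨s, hs⟩, c, hc, (G.Δhat_mul_opT ⟨s, hs⟩ c).symm⟩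

lemma star_Δhat_mul_opT (s : G.Ahat.alg) (c : H →L[ℂ] H) :
    star ((G.Δhat s : HTensor H H →L[ℂ] HTensor H H) * opT c 1) =
      opT (star c) 1 * (G.Δhat (star s) : HTensor H H →L[ℂ] HTensor H H) := by
  rw [star_mul, star_opT, star_one, map_star]
  rfl

/-- The cancellation property `(Â ⊗ 1)Δ̂(Â) = Â ⊗ Â`. -/
lemma cancellation : cls {x | ∃ c ∈ G.Ahat.alg, ∃ s : G.Ahat.alg,
    x = opT c 1 * (G.Δhat s : HTensor H H →L[ℂ] HTensor H H)} = (G.Ahat.tensor G.Ahat).alg := by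
  refine cls_eq_alg ?_ ?_
  · rintro _ ⟨c, hc, s, rfl⟩
    have h : (G.Δhat (star s) : HTensor H H →L[ℂ] HTensor H H) * opT (star c) 1 ∈
        (G.Ahat.tensor G.Ahat).alg :=
      (mem_alg_of_eq G.cancellation_right).1 (subset_cls _ ⟨star s, star c, star_mem hc, rfl⟩)
    have h2 := G.star_Δhat_mul_opT (star s) (star c)
    rw [star_star, star_star] at h2
    rw [← h2]
    exact star_mem h
  · intro x hx
    refine star_mem_cls ?_ ((mem_alg_of_eq G.cancellation_right).2 (star_mem hx))
    rintro _ ⟨s, c, hc, rfl⟩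
    exact subset_cls _ ⟨star c, star_mem hc, star s, G.star_Δhat_mul_opT s c⟩

end QuantumGroup

end QG

/-! ### Conjugation of a morphism by a unitary multiplier -/

namespace QG

namespace Mor

section

variable {H : Type*} [NormedAddCommGroup H] [InnerProductSpace ℂ H] [CompleteSpace H]
  {K : Type*} [NormedAddCommGroup K] [InnerProductSpace ℂ K] [CompleteSpace K]
  {L : Type*} [NormedAddCommGroup L] [InnerProductSpace ℂ L] [CompleteSpace L]
  {A : CStarOp H} {B : CStarOp K} {C : CStarOp L}

/-- Non-degeneracy survives conjugation because uC = C = u*C: approximate ux by elements φ(a)c and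
multiply by u*, using u*φ(a)c = (u*φ(a)u)(u*c). -/
lemma mem_cls_conj (φ : Mor A C) {u : C.mult} (hu : u ∈ unitary C.mult) {x : L →L[ℂ] L}
    (hx : x ∈ C.alg) : x ∈ cls {x : L →L[ℂ] L | ∃ a : A.alg, ∃ c ∈ C.alg,
      x = ((star u * φ a * u : C.mult) : L →L[ℂ] L) * c} := by
  obtain ⟨U, hU⟩ := u
  have h1 : star U * U = 1 := congrArg Subtype.val hu.1
  have h2 : U * star U = 1 := congrArg Subtype.val hu.2
  have h3 : x = sandwich (star U) 1 (U * x) := by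
    rw [sandwich_apply_mul, mul_one, ← mul_assoc, h1, one_mul]
  rw [h3]
  refine map_mem_cls _ ?_ ((mem_alg_of_eq φ.nondeg).2 (hU x hx).1)
  rintro _ ⟨a, c, hc, rfl⟩
  refine subset_cls _ ⟨a, star U * c, (star_mem hU c hc).1, ?_⟩
  rw [sandwich_apply_mul, mul_one]
  change star U * ((φ a : L →L[ℂ] L) * c) = star U * (φ a : L →L[ℂ] L) * U * (star U * c)
  generalize (φ a : L →L[ℂ] L) = f
  rw [mul_assoc (star U * f), ← mul_assoc U, h2, one_mul, mul_assoc]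

/-- The morphism `a ↦ u* φ(a) u` for a unitary multiplier `u`. -/
def conj (φ : Mor A C) (u : C.mult) (hu : u ∈ unitary C.mult) : Mor A C where
  hom :=
    { toFun := fun a => star u * φ a * u
      map_smul' := fun c a => by
        rw [map_smul, mul_smul_comm, smul_mul_assoc]; rfl
      map_zero' := by rw [map_zero, mul_zero, zero_mul]
      map_add' := fun a b => by rw [map_add, mul_add, add_mul]
      map_mul' := fun a b => by
        rw [map_mul]
        calc star u * (φ a * φ b) * u = star u * φ a * 1 * φ b * u := by simp only [mul_assoc, one_mul]
          _ = star u * φ a * (u * star u) * φ b * u := by rw [hu.2]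
          _ = star u * φ a * u * (star u * φ b * u) := by simp only [mul_assoc]
      map_star' := fun a => by
        rw [map_star, star_mul, star_mul, star_star, mul_assoc] }
  nondeg := by
    refine cls_eq_alg ?_ fun x hx => φ.mem_cls_conj hu hx
    rintro _ ⟨a, c, hc, rfl⟩
    exact ((star u * φ a * u).2 c hc).1

lemma conj_apply (φ : Mor A C) (u : C.mult) (hu : u ∈ unitary C.mult) (a : A.alg) :
    φ.conj u hu a = star u * φ a * u := rfl

lemma conj_mul_mul_star (φ : Mor A C) (u : C.mult) (hu : u ∈ unitary C.mult) (a : A.alg) :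
    u * φ.conj u hu a * star u = φ a := by
  calc u * (star u * φ a * u) * star u = (u * star u) * φ a * (u * star u) := by
        simp only [mul_assoc]
    _ = φ a := by rw [hu.2, one_mul, mul_one]

lemma conj_injective (φ : Mor A C) (u : C.mult) (hu : u ∈ unitary C.mult)
    (hφ : Function.Injective φ.hom) : Function.Injective (φ.conj u hu).hom := fun a b h =>
  hφ <| by rw [← φ.conj_mul_mul_star u hu, ← φ.conj_mul_mul_star u hu, h]

lemma conj_ext (φ : Mor A C) (u : C.mult) (hu : u ∈ unitary C.mult) (m : A.mult) :
    (φ.conj u hu).ext m = star u * φ.ext m * u :=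
  Subtype.ext <| ext_eq_of_mul _ m fun a => by
    rw [conj_apply, conj_apply, ← ext_mul_hom, ← coe_mult_mul]
    congr 1
    calc star u * φ.ext m * u * (star u * φ a * u) =
        star u * φ.ext m * (u * star u) * φ a * u := by simp only [mul_assoc]
      _ = star u * (φ.ext m * φ a) * u := by rw [hu.2, mul_one, mul_assoc (star u)]

lemma ext_unitary (φ : Mor A C) {m : A.mult} (hm : m ∈ unitary A.mult) :
    φ.ext m ∈ unitary C.mult := by
  refine ⟨?_, ?_⟩
  · rw [← map_star, ← map_mul, hm.1, map_one]
  · rw [← map_star, ← map_mul, hm.2, map_one]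

lemma multT_mul (m m' : A.mult) (n n' : B.mult) :
    A.multT B m n * A.multT B m' n' = A.multT B (m * m') (n * n') :=
  Subtype.ext (opT_mul _ _ _ _)

lemma star_multT (m : A.mult) (n : B.mult) :
    star (A.multT B m n) = A.multT B (star m) (star n) :=
  Subtype.ext (star_opT _ _)

lemma multT_one : A.multT B 1 1 = 1 := Subtype.ext opT_one

lemma multT_unitary {m : A.mult} {n : B.mult} (hm : m ∈ unitary A.mult)
    (hn : n ∈ unitary B.mult) : A.multT B m n ∈ unitary (A.tensor B).mult := by
  refine ⟨?_, ?_⟩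
  · rw [star_multT, multT_mul, hm.1, hn.1, multT_one]
  · rw [star_multT, multT_mul, hm.2, hn.2, multT_one]

lemma idTensor_conj (A : CStarOp H) (φ : Mor B C) (u : C.mult) (hu : u ∈ unitary C.mult) :
    idTensor A (φ.conj u hu) =
      (idTensor A φ).conj (A.multT C 1 u) (multT_unitary (one_mem _) hu) :=
  hom_ext_tensor fun a b => by
    rw [conj_apply, idTensor_algT', idTensor_algT', conj_apply, star_multT, multT_mul, multT_mul,
      star_one, one_mul, mul_one]

/-- An element commuting with the image of elementary tensors commutes with the image of
`M(A ⊗ B)`. -/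
lemma ext_commute_of_algT (φ : Mor (A.tensor B) C) {v : C.mult}
    (h : ∀ a b, v * φ (A.algT B a b) = φ (A.algT B a b) * v) (m : (A.tensor B).mult) :
    v * φ.ext m = φ.ext m * v := by
  refine Subtype.ext (φ.ext_commute (fun x => ?_) m)
  have := eq_of_algT (A := A) (B := B)
    (f := (ContinuousLinearMap.mul ℂ (L →L[ℂ] L) v).comp φ.toCLM)
    (g := ((ContinuousLinearMap.mul ℂ (L →L[ℂ] L)).flip v).comp φ.toCLM)
    (fun a b => congrArg Subtype.val (h a b))
  exact congrArg (fun f => f x) this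

/-- The algebra behind coassociativity: conjugating by pv is conjugating by wq, and w drops out
because it is an isometry commuting with x. In the application p and q are the images of U under id
⊗ β and Δ̂ ⊗ id, v is U₂₃ and w is Ω₁₂. -/
lemma conj_cocycle_identity {R : Type*} [Monoid R] [StarMul R] {p q v w x : R}
    (h : p * v = w * q) (hw : star w * w = 1) (hx : w * x = x * w) :
    star v * (star p * x * p) * v = star q * x * q := by
  calc star v * (star p * x * p) * v = star (p * v) * x * (p * v) := by
        simp only [star_mul, mul_assoc]
    _ = star q * (star w * (x * w)) * q := by rw [h]; simp only [star_mul, mul_assoc]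
    _ = star q * x * q := by rw [← hx, ← mul_assoc (star w), hw, one_mul]

lemma ext_ext_congr {M N : Type*} [NormedAddCommGroup M] [InnerProductSpace ℂ M]
    [CompleteSpace M] [NormedAddCommGroup N] [InnerProductSpace ℂ N] [CompleteSpace N]
    {D : CStarOp M} {E : CStarOp N} {χ : Mor B D} {φ : Mor A B} {χ' : Mor E D} {φ' : Mor A E}
    (h : χ.comp φ = χ'.comp φ') (m : A.mult) : χ.ext (φ.ext m) = χ'.ext (φ'.ext m) := by
  rw [← comp_ext, ← comp_ext, h]

lemma ext_commute_ext (φ : Mor A C) {m n : A.mult} (h : m * n = n * m) :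
    φ.ext m * φ.ext n = φ.ext n * φ.ext m := by
  rw [← map_mul, h, map_mul]

/-- The abstract form of the coassociativity of a twisted action. -/
lemma conj_ext_eq_ext {M : Type*} [NormedAddCommGroup M] [InnerProductSpace ℂ M]
    [CompleteSpace M] {E : CStarOp M} (P Q : Mor A C) (Θ : Mor E C) {u x : A.mult}
    {r s ω ω' : E.mult} {v w : C.mult} (hv : v ∈ unitary C.mult) (hw : w ∈ unitary C.mult)
    (hP : P.ext u = Θ.ext r) (hQ : Q.ext u = Θ.ext s) (hω : Θ.ext ω = v) (hω' : Θ.ext ω' = w)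
    (h : r * ω = ω' * s) (hcomm : w * Q.ext x = Q.ext x * w) (hx : P.ext x = Q.ext x) :
    (P.conj v hv).ext (star u * x * u) = Q.ext (star u * x * u) := by
  rw [conj_ext]
  simp only [map_mul, map_star, hx]
  refine conj_cocycle_identity (w := w) ?_ hw.1 hcomm
  rw [hP, hQ, ← hω, ← hω', ← map_mul, ← map_mul, h]

end

end Mor

/-! ### Coassociativity of the twisted action -/

namespace QuantumGroup

variable {H : Type*} [NormedAddCommGroup H] [InnerProductSpace ℂ H] [CompleteSpace H]
  (G : QuantumGroup H) {K : Type*} [NormedAddCommGroup K] [InnerProductSpace ℂ K]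
  [CompleteSpace K]

variable {G} {Ω : (G.Ahat.tensor G.Ahat).mult} {B : CStarOp K} {β : Mor B (G.Ahat.tensor B)}
  {ψ : Mor G.Ahat B}

lemma HasTrivialTwist.commute (hT : G.HasTrivialTwist Ω)
    (hΩ : Ω ∈ unitary (G.Ahat.tensor G.Ahat).mult) (a : G.Ahat.alg) :
    Ω * G.Δhat a = G.Δhat a * Ω := by
  calc Ω * G.Δhat a = Ω * (star Ω * G.Δhat a * Ω) := by rw [hT a]
    _ = (Ω * star Ω) * (G.Δhat a * Ω) := by simp only [mul_assoc]
    _ = G.Δhat a * Ω := by rw [hΩ.2, one_mul]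

lemma IsGProduct.comp_eq (hB : G.IsGProduct B β ψ) :
    β.comp ψ = (Mor.idTensor G.Ahat ψ).comp G.Δhat :=
  Mor.hom_ext fun a => congrArg Subtype.val (hB.comm a)

/-- This is βψ = (id ⊗ ψ)Δ̂ in the second leg; it writes (id ⊗ β)(U) as an image of (id ⊗ Δ̂)(Ω). -/
lemma IsGProduct.idTensor_ext (hB : G.IsGProduct B β ψ) (m : (G.Ahat.tensor G.Ahat).mult) :
    (Mor.idTensor G.Ahat β).ext ((Mor.idTensor G.Ahat ψ).ext m) =
      (Mor.idTensor G.Ahat (Mor.idTensor G.Ahat ψ)).ext ((Mor.idTensor G.Ahat G.Δhat).ext m) := by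
  refine Mor.ext_ext_congr ?_ m
  exact (Mor.idTensor_comp _ _ _).symm.trans
    ((congrArg (Mor.idTensor G.Ahat) hB.comp_eq).trans (Mor.idTensor_comp _ _ _))

variable (G B) in
/-- The morphism `Δ̂ ⊗ id`, with values in `Â ⊗ (Â ⊗ B)`. -/
def comulMor : Mor (G.Ahat.tensor B) (G.Ahat.tensor (G.Ahat.tensor B)) :=
  (assocMor G.Ahat G.Ahat B).comp (Mor.tensorId G.Δhat B)

lemma comulMor_ext (m : (G.Ahat.tensor B).mult) :
    (G.comulMor B).ext m = (assocMor G.Ahat G.Ahat B).ext ((Mor.tensorId G.Δhat B).ext m) :=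
  Mor.comp_ext _ _ m

lemma coe_comulMor_ext (m : (G.Ahat.tensor B).mult) :
    ((G.comulMor B).ext m : HTensor H (HTensor H K) →L[ℂ] HTensor H (HTensor H K)) =
      reassoc ((Mor.tensorId G.Δhat B).ext m : HTensor (HTensor H H) K →L[ℂ] _) := by
  rw [comulMor_ext]
  exact assocMor_ext _ _ _ _

lemma assocMor_ext_idTensor_ext (ψ : Mor G.Ahat B)
    (m : ((G.Ahat.tensor G.Ahat).tensor G.Ahat).mult) :
    (assocMor G.Ahat G.Ahat B).ext ((Mor.idTensor (G.Ahat.tensor G.Ahat) ψ).ext m) =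
      (Mor.idTensor G.Ahat (Mor.idTensor G.Ahat ψ)).ext
        ((assocMor G.Ahat G.Ahat G.Ahat).ext m) :=
  Mor.ext_ext_congr (assocMor_naturality _ _ _ ψ).symm m

/-- The comultiplication acts on the first leg and ψ on the last, so they commute up to
rebracketing. Together with `IsGProduct.idTensor_ext` it lets the cocycle identity be transported by
id ⊗ id ⊗ ψ. -/
lemma comulMor_ext_idTensor_ext (ψ : Mor G.Ahat B) (m : (G.Ahat.tensor G.Ahat).mult) :
    (G.comulMor B).ext ((Mor.idTensor G.Ahat ψ).ext m) =
      (Mor.idTensor G.Ahat (Mor.idTensor G.Ahat ψ)).ext ((G.comulMor G.Ahat).ext m) := by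
  have h1 := congrArg (assocMor G.Ahat G.Ahat B).ext
    (Mor.ext_ext_congr (Mor.tensorId_comp_idTensor G.Δhat ψ) m)
  have h2 := congrArg (Mor.idTensor G.Ahat (Mor.idTensor G.Ahat ψ)).ext
    (comulMor_ext (B := G.Ahat) m)
  exact (comulMor_ext _).trans (h1.trans ((assocMor_ext_idTensor_ext ψ _).trans h2.symm))

variable (Ω B) in
/-- The unitary `Ω₁₂`. -/
def leg12Mult : (G.Ahat.tensor (G.Ahat.tensor B)).mult :=
  (assocMor G.Ahat G.Ahat B).ext ((G.Ahat.tensor G.Ahat).multT B Ω 1)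

lemma idTensor_ext_leg12Mult (ψ : Mor G.Ahat B) :
    (Mor.idTensor G.Ahat (Mor.idTensor G.Ahat ψ)).ext (leg12Mult Ω G.Ahat) = leg12Mult Ω B := by
  refine (assocMor_ext_idTensor_ext ψ _).symm.trans (congrArg (assocMor G.Ahat G.Ahat B).ext ?_)
  refine (Mor.idTensor_ext_multT _ ψ _ _).trans ?_
  rw [map_one]

/-- On elementary tensors this is the commutation of Ω ⊗ 1 with Δ̂(a) ⊗ b, which is the trivial
twist. -/
lemma leg12Mult_commute (hT : G.HasTrivialTwist Ω)
    (hΩ : Ω ∈ unitary (G.Ahat.tensor G.Ahat).mult) (m : (G.Ahat.tensor B).mult) :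
    leg12Mult Ω B * (G.comulMor B).ext m = (G.comulMor B).ext m * leg12Mult Ω B := by
  rw [comulMor_ext]
  refine Mor.ext_commute_ext _ ?_
  refine Mor.ext_commute_of_algT _ (fun a b => ?_) m
  have h : Mor.tensorId G.Δhat B (G.Ahat.algT B a b) =
      (G.Ahat.tensor G.Ahat).multT B (G.Δhat a) (B.toMult b) :=
    Subtype.ext (Mor.tensorId_algT G.Δhat B a b)
  rw [h, Mor.multT_mul, Mor.multT_mul, hT.commute hΩ, one_mul, mul_one]

/-- On elementary tensors 1 ⊗ Ω meets a ⊗ Δ̂(b), so the trivial twist applies again. This reverses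
the order of the factors on the right of the cocycle identity, as the twisted action requires. -/
lemma leg23Mult_commute (hT : G.HasTrivialTwist Ω)
    (hΩ : Ω ∈ unitary (G.Ahat.tensor G.Ahat).mult) (m : (G.Ahat.tensor G.Ahat).mult) :
    G.Ahat.multT (G.Ahat.tensor G.Ahat) 1 Ω * (Mor.idTensor G.Ahat G.Δhat).ext m =
      (Mor.idTensor G.Ahat G.Δhat).ext m * G.Ahat.multT (G.Ahat.tensor G.Ahat) 1 Ω := by
  refine Mor.ext_commute_of_algT _ (fun a b => ?_) m
  rw [Mor.idTensor_algT', Mor.multT_mul, Mor.multT_mul, hT.commute hΩ, one_mul, mul_one]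

lemma IsUnitaryTwoCocycle.mult_eq (hΩ : G.IsUnitaryTwoCocycle Ω) :
    leg12Mult Ω G.Ahat * (G.comulMor G.Ahat).ext Ω =
      G.Ahat.multT (G.Ahat.tensor G.Ahat) 1 Ω * (Mor.idTensor G.Ahat G.Δhat).ext Ω := by
  refine Subtype.ext ?_
  refine Eq.trans ?_ hΩ.cocycle
  rw [coe_mult_mul, coe_comulMor_ext, reassoc_mul]
  congr 1
  exact assocMor_ext _ _ _ _

/-- The coassociativity of the twisted action. -/
lemma IsGProduct.coassoc_conj (hB : G.IsGProduct B β ψ) (hΩ : G.IsUnitaryTwoCocycle Ω)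
    (hT : G.HasTrivialTwist Ω)
    (hu : (Mor.idTensor G.Ahat ψ).ext Ω ∈ unitary (G.Ahat.tensor B).mult) (b : B.alg) :
    (Mor.idTensor G.Ahat (β.conj _ hu)).ext (β.conj _ hu b) =
      (G.comulMor B).ext (β.conj _ hu b) := by
  rw [Mor.idTensor_conj]
  -- Here P = id ⊗ β, Q = Δ̂ ⊗ id and Θ = id ⊗ id ⊗ ψ, with r = (id ⊗ Δ̂)(Ω), s = (Δ̂ ⊗ id)(Ω), ω =
  -- Ω₂₃ and ω' = Ω₁₂. The relation rω = ω's is the cocycle identity after commuting Ω₂₃ past r.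
  exact Mor.conj_ext_eq_ext (Mor.idTensor G.Ahat β) (G.comulMor B)
    (Mor.idTensor G.Ahat (Mor.idTensor G.Ahat ψ)) _
    (Mor.ext_unitary _ (Mor.multT_unitary hΩ.isUnitary (one_mem _)))
    (hB.idTensor_ext Ω) (comulMor_ext_idTensor_ext ψ Ω)
    (Mor.idTensor_ext_multT _ _ _ _) (idTensor_ext_leg12Mult ψ)
    ((leg23Mult_commute hT hΩ.isUnitary Ω).symm.trans hΩ.mult_eq.symm)
    (leg12Mult_commute hT hΩ.isUnitary _)
    (Subtype.ext ((hB.action.coassoc b).trans (coe_comulMor_ext _).symm))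

end QuantumGroup

end QG

/-! ### The Podleś condition for the twisted action -/

namespace QG

section

variable {H : Type*} [NormedAddCommGroup H] [InnerProductSpace ℂ H] [CompleteSpace H]
  {K : Type*} [NormedAddCommGroup K] [InnerProductSpace ℂ K] [CompleteSpace K]

/-- The product `zm` of `z` in a C⋆-algebra with a multiplier `m`. -/
def CStarOp.mulR (A : CStarOp K) (z : A.alg) (m : A.mult) : A.alg :=
  ⟨(z : K →L[ℂ] K) * m, (m.2 z z.2).2⟩

lemma CStarOp.toMult_mulR (A : CStarOp K) (z : A.alg) (m : A.mult) :
    A.toMult (A.mulR z m) = A.toMult z * m := rfl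

lemma CStarOp.mulR_mul (A : CStarOp K) (z : A.alg) {m n : A.mult} (h : m * n = 1) :
    A.mulR (A.mulR z m) n = z := by
  refine Subtype.ext ?_
  change (z : K →L[ℂ] K) * m * n = z
  rw [mul_assoc, ← coe_mult_mul, h]
  exact mul_one _

namespace Mor

lemma mulR_apply {A : CStarOp H} {C : CStarOp K} (φ : Mor A C) (z : A.alg)
    (m : A.mult) : φ (A.mulR z m) = φ z * φ.ext m := by
  rw [← ext_toMult, CStarOp.toMult_mulR, map_mul, ext_toMult]

lemma ext_mul_star_ext {A : CStarOp H} {C : CStarOp K} (φ : Mor A C) {m n : A.mult}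
    (h : m * star n = star n * m) : φ.ext m * star (φ.ext n) = star (φ.ext n) * φ.ext m := by
  rw [← map_star, ← map_mul, h, map_mul]

lemma mem_cls_of_generators {A : CStarOp H} {S : Set (H →L[ℂ] H)}
    (hS : (A.alg : Set (H →L[ℂ] H)) = cls S) {T : Set (K →L[ℂ] K)} (f : A.alg →L[ℂ] (K →L[ℂ] K))
    (h : ∀ a : A.alg, (a : H →L[ℂ] H) ∈ S → f a ∈ cls T) (a : A.alg) : f a ∈ cls T :=
  induction_cls hS f (Submodule.span ℂ T).topologicalClosure (isClosed_cls T) h a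

/-- A closed linear property of elements of `C = φ(A)C` holds if it holds for products
`φ(a)c`. -/
lemma induction_mul {A : CStarOp H} {C : CStarOp K} (φ : Mor A C) {E : Type*}
    [NormedAddCommGroup E] [NormedSpace ℂ E] (f : C.alg →L[ℂ] E) (T : Submodule ℂ E)
    (hT : IsClosed (T : Set E)) (h : ∀ a c, f (mulL C (φ a) c) ∈ T) (c : C.alg) : f c ∈ T := by
  refine induction_cls φ.nondeg.symm f T hT ?_ c
  rintro ⟨_, _⟩ ⟨a, c, hc, rfl⟩
  exact h a ⟨c, hc⟩

end Mor

lemma mul_conj_of_commute {R : Type*} [Monoid R] (p : R) {d v u : R} (h : d * v = v * d) (x : R) :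
    p * d * (v * x * u) = p * (v * (d * x) * u) := by
  calc p * d * (v * x * u) = p * (d * v) * x * u := by simp only [mul_assoc]
    _ = p * (v * (d * x) * u) := by rw [h]; simp only [mul_assoc]

lemma mul_conj_cancel {R : Type*} [Monoid R] {u v : R} (h : u * v = 1) (x : R) :
    u * (v * x * u) = x * u := by
  rw [← mul_assoc, ← mul_assoc, h, one_mul]

/-- Since C = Cu for a unitary multiplier u, the trailing U in β^Ω(b) = U*β(b)U costs nothing. -/
lemma mem_cls_of_mul_unitary {C : CStarOp K} {T : Set (K →L[ℂ] K)} {u : C.mult}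
    (hu : u ∈ unitary C.mult) (h : ∀ x ∈ C.alg, x * (u : K →L[ℂ] K) ∈ cls T) {x : K →L[ℂ] K}
    (hx : x ∈ C.alg) : x ∈ cls T := by
  have h1 : ((C.mulR (C.mulR ⟨x, hx⟩ (star u)) u : C.alg) : K →L[ℂ] K) = x := by
    rw [C.mulR_mul _ hu.1]
  rw [← h1]
  exact h _ (C.mulR ⟨x, hx⟩ (star u)).2

end

namespace QuantumGroup

variable {H : Type*} [NormedAddCommGroup H] [InnerProductSpace ℂ H] [CompleteSpace H]
  (G : QuantumGroup H) {K : Type*} [NormedAddCommGroup K] [InnerProductSpace ℂ K]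
  [CompleteSpace K]

variable {G} {Ω : (G.Ahat.tensor G.Ahat).mult} {B : CStarOp K} {β : Mor B (G.Ahat.tensor B)}
  {ψ : Mor G.Ahat B}

/-- The bounded linear map `z ↦ (id ⊗ ψ)(z) y`. -/
def idTensorMul (ψ : Mor G.Ahat B) (y : (G.Ahat.tensor B).mult) :
    (G.Ahat.tensor G.Ahat).alg →L[ℂ] (HTensor H K →L[ℂ] HTensor H K) :=
  ((ContinuousLinearMap.mul ℂ (HTensor H K →L[ℂ] HTensor H K)).flip y).comp
    (Mor.idTensor G.Ahat ψ).toCLM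

lemma idTensorMul_apply (ψ : Mor G.Ahat B) (y : (G.Ahat.tensor B).mult)
    (z : (G.Ahat.tensor G.Ahat).alg) :
    idTensorMul ψ y z = ((Mor.idTensor G.Ahat ψ z * y : (G.Ahat.tensor B).mult) :
      HTensor H K →L[ℂ] HTensor H K) := rfl

/-- Moves U or U* from the front of y into z as Ω or Ω*. As Â ⊗ Â is stable under multiplication by
multipliers, the factor is then absorbed. -/
lemma idTensorMul_mulR (ψ : Mor G.Ahat B) (y : (G.Ahat.tensor B).mult)
    (z : (G.Ahat.tensor G.Ahat).alg) (m : (G.Ahat.tensor G.Ahat).mult) :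
    idTensorMul ψ y ((G.Ahat.tensor G.Ahat).mulR z m) =
      idTensorMul ψ ((Mor.idTensor G.Ahat ψ).ext m * y) z := by
  rw [idTensorMul_apply, idTensorMul_apply, Mor.mulR_apply, mul_assoc]

lemma idTensorMul_algT (ψ : Mor G.Ahat B) (y : (G.Ahat.tensor B).mult) (p q : G.Ahat.alg) :
    idTensorMul ψ y (G.Ahat.algT G.Ahat p q) =
      opT 1 (ψ q : K →L[ℂ] K) * (opT (p : H →L[ℂ] H) 1 * (y : HTensor H K →L[ℂ] HTensor H K)) := by
  rw [idTensorMul_apply, coe_mult_mul, Mor.idTensor_algT, ← mul_assoc, opT_mul, one_mul, mul_one]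

/-- The element `(c ⊗ 1)Δ̂(s)` of `Â ⊗ Â`. -/
def mulΔhat (c s : G.Ahat.alg) : (G.Ahat.tensor G.Ahat).alg :=
  ⟨opT (c : H →L[ℂ] H) 1 * (G.Δhat s : HTensor H H →L[ℂ] HTensor H H),
    (mem_alg_of_eq G.cancellation).1 (subset_cls _ ⟨c, c.2, s, rfl⟩)⟩

lemma idTensor_mulΔhat (ψ : Mor G.Ahat B) (c s : G.Ahat.alg) :
    Mor.idTensor G.Ahat ψ (mulΔhat c s) =
      G.Ahat.multT B (G.Ahat.toMult c) 1 * (Mor.idTensor G.Ahat ψ).ext (G.Δhat s) := by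
  have h : (G.Ahat.tensor G.Ahat).toMult (mulΔhat c s) =
      G.Ahat.multT G.Ahat (G.Ahat.toMult c) 1 * G.Δhat s := rfl
  rw [← Mor.ext_toMult, h, map_mul, Mor.idTensor_ext_multT, map_one]

/-- The key computation: (id ⊗ ψ)Δ̂(s) commutes with U* by the trivial twist and equals βψ(s), so it
is absorbed into β^Ω(b) as the factor ψ(s). -/
lemma idTensorMul_conj (hB : G.IsGProduct B β ψ) (hT : G.HasTrivialTwist Ω)
    (hΩ : Ω ∈ unitary (G.Ahat.tensor G.Ahat).mult)
    (hu : (Mor.idTensor G.Ahat ψ).ext Ω ∈ unitary (G.Ahat.tensor B).mult)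
    (c s : G.Ahat.alg) (b : B.alg) :
    idTensorMul ψ (β.conj _ hu b) (mulΔhat c s) =
      opT (c : H →L[ℂ] H) 1 * (β.conj _ hu (Mor.mulL B (ψ s) b) :
        HTensor H K →L[ℂ] HTensor H K) := by
  have h1 : β (Mor.mulL B (ψ s) b) = (Mor.idTensor G.Ahat ψ).ext (G.Δhat s) * β b := by
    rw [← Mor.ext_mul_hom, hB.comm]
  have h2 : (Mor.idTensor G.Ahat ψ).ext (G.Δhat s) * star ((Mor.idTensor G.Ahat ψ).ext Ω) =
      star ((Mor.idTensor G.Ahat ψ).ext Ω) * (Mor.idTensor G.Ahat ψ).ext (G.Δhat s) := by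
    refine Mor.ext_mul_star_ext _ ?_
    calc G.Δhat s * star Ω = star Ω * G.Δhat s * Ω * star Ω := by rw [hT s]
      _ = star Ω * G.Δhat s := by rw [mul_assoc, hΩ.2, mul_one]
  have h3 := congrArg (fun t => t * β.conj _ hu b) (idTensor_mulΔhat ψ c s)
  have h4 := mul_conj_of_commute (u := (Mor.idTensor G.Ahat ψ).ext Ω)
    (G.Ahat.multT B (G.Ahat.toMult c) 1) h2 (β b)
  have h5 := congrArg (fun t => G.Ahat.multT B (G.Ahat.toMult c) 1 *
    (star ((Mor.idTensor G.Ahat ψ).ext Ω) * t * (Mor.idTensor G.Ahat ψ).ext Ω)) h1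
  exact congrArg Subtype.val (h3.trans (h4.trans h5.symm))

/-- For z = p ⊗ q the value is (1 ⊗ ψ(q)) (p ⊗ 1)β(b) u; the middle factor is in Â ⊗ B by the Podleś
condition for β, and the outer ones are multipliers. -/
lemma IsContinuousLeftAction.idTensorMul_mem (hB : G.IsContinuousLeftAction B β)
    (ψ : Mor G.Ahat B) (u : (G.Ahat.tensor B).mult) (b : B.alg)
    (z : (G.Ahat.tensor G.Ahat).alg) : idTensorMul ψ (β b * u) z ∈ (G.Ahat.tensor B).alg := by
  refine Mor.induction_cls (CStarOp.coe_tensor G.Ahat G.Ahat)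
    (idTensorMul ψ (β b * u)) (G.Ahat.tensor B).alg.toSubmodule
    (G.Ahat.tensor B).isClosed ?_ z
  rintro ⟨_, _⟩ ⟨p, hp, q, hq, rfl⟩
  have h2 := idTensorMul_algT ψ (β b * u) ⟨p, hp⟩ ⟨q, hq⟩
  have h3 : opT p 1 * (β b : HTensor H K →L[ℂ] HTensor H K) ∈ (G.Ahat.tensor B).alg :=
    (mem_alg_of_eq hB.podles).1 (subset_cls _ ⟨p, hp, b, rfl⟩)
  have h4 := (opT_mem_mult G.Ahat.mult.one_mem (ψ ⟨q, hq⟩).2 _ (u.2 _ h3).2).1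
  rw [coe_mult_mul, ← mul_assoc (opT p 1)] at h2
  exact Eq.mpr (congrArg (fun y => y ∈ (G.Ahat.tensor B).alg) h2) h4

lemma ext_mul_conj (ψ : Mor G.Ahat B)
    (hu : (Mor.idTensor G.Ahat ψ).ext Ω ∈ unitary (G.Ahat.tensor B).mult) (b : B.alg) :
    (Mor.idTensor G.Ahat ψ).ext Ω * β.conj _ hu b = β b * (Mor.idTensor G.Ahat ψ).ext Ω :=
  mul_conj_cancel hu.2 _

lemma ext_star_mul (ψ : Mor G.Ahat B)
    (hu : (Mor.idTensor G.Ahat ψ).ext Ω ∈ unitary (G.Ahat.tensor B).mult) (b : B.alg) :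
    (Mor.idTensor G.Ahat ψ).ext (star Ω) * (β b * (Mor.idTensor G.Ahat ψ).ext Ω) =
      β.conj _ hu b := by
  rw [map_star, ← mul_assoc]; rfl

lemma IsContinuousLeftAction.idTensorMul_conj_mem (hB : G.IsContinuousLeftAction B β)
    (ψ : Mor G.Ahat B)
    (hu : (Mor.idTensor G.Ahat ψ).ext Ω ∈ unitary (G.Ahat.tensor B).mult) (b : B.alg)
    (z : (G.Ahat.tensor G.Ahat).alg) :
    idTensorMul ψ (β.conj _ hu b) z ∈ (G.Ahat.tensor B).alg := by
  rw [← ext_star_mul, ← idTensorMul_mulR]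
  exact hB.idTensorMul_mem ψ _ b _

/-- The operators `(a ⊗ 1)β(b)`. -/
def podlesSet (β : Mor B (G.Ahat.tensor B)) : Set (HTensor H K →L[ℂ] HTensor H K) :=
  {x | ∃ a ∈ G.Ahat.alg, ∃ b : B.alg, x = opT a 1 * (β b : HTensor H K →L[ℂ] HTensor H K)}

/-- Since β(b)U = Uβ^Ω(b), the value is that of zΩ ∈ Â ⊗ Â against β^Ω(b). By cancellation zΩ is a
limit of sums of (c ⊗ 1)Δ̂(s), to which `idTensorMul_conj` applies. -/
lemma IsGProduct.idTensorMul_mem_cls (hB : G.IsGProduct B β ψ) (hT : G.HasTrivialTwist Ω)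
    (hΩ : Ω ∈ unitary (G.Ahat.tensor G.Ahat).mult)
    (hu : (Mor.idTensor G.Ahat ψ).ext Ω ∈ unitary (G.Ahat.tensor B).mult) (b : B.alg)
    (z : (G.Ahat.tensor G.Ahat).alg) :
    idTensorMul ψ (β b * (Mor.idTensor G.Ahat ψ).ext Ω) z ∈ cls (podlesSet (β.conj _ hu)) := by
  rw [← ext_mul_conj ψ hu, ← idTensorMul_mulR]
  refine Mor.mem_cls_of_generators G.cancellation.symm (idTensorMul ψ (β.conj _ hu b)) ?_ _
  rintro ⟨_, _⟩ ⟨c, hc, s, rfl⟩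
  exact subset_cls _ ⟨c, hc, _, idTensorMul_conj hB hT hΩ hu ⟨c, hc⟩ s b⟩

/-- The Podleś condition for the twisted action. -/
lemma IsGProduct.podles_conj (hB : G.IsGProduct B β ψ) (hT : G.HasTrivialTwist Ω)
    (hΩ : Ω ∈ unitary (G.Ahat.tensor G.Ahat).mult)
    (hu : (Mor.idTensor G.Ahat ψ).ext Ω ∈ unitary (G.Ahat.tensor B).mult) :
    cls (podlesSet (β.conj _ hu)) = (G.Ahat.tensor B).alg := by
  refine cls_eq_alg ?_ fun x hx => mem_cls_of_mul_unitary hu (fun x hx => ?_) hx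
  · rintro _ ⟨a, ha, b, rfl⟩
    -- By B = ψ(Â)B it suffices to treat ψ(s)b, where `idTensorMul_conj` rewrites (a ⊗ 1)β^Ω(ψ(s)b)
    -- as a value of `idTensorMul`.
    refine ψ.induction_mul
      ((ContinuousLinearMap.mul ℂ (HTensor H K →L[ℂ] HTensor H K) (opT a 1)).comp
        (β.conj _ hu).toCLM) (G.Ahat.tensor B).alg.toSubmodule (G.Ahat.tensor B).isClosed ?_ b
    intro s b
    have h1 := idTensorMul_conj hB hT hΩ hu ⟨a, ha⟩ s b
    have h2 := hB.action.idTensorMul_conj_mem ψ hu b (mulΔhat ⟨a, ha⟩ s)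
    rw [h1] at h2
    exact h2
  · generalize hu' : (Mor.idTensor G.Ahat ψ).ext Ω = u at *
    -- The goal is (Â ⊗ B)U inside the closed span. It is reached from the products (1 ⊗ ψ(q))(p ⊗
    -- 1)β(b)U, first by the Podleś condition for β and then by B = ψ(Â)B in the second leg.
    have key : ∀ (q p : G.Ahat.alg) (b : B.alg), opT 1 (ψ q : K →L[ℂ] K) *
        (opT (p : H →L[ℂ] H) 1 * (β b : HTensor H K →L[ℂ] HTensor H K)) *
        (u : HTensor H K →L[ℂ] HTensor H K) ∈ cls (podlesSet (β.conj u hu)) := by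
      subst hu'
      intro q p b
      have h2 := idTensorMul_algT ψ (β b * (Mor.idTensor G.Ahat ψ).ext Ω) p q
      have h3 := hB.idTensorMul_mem_cls hT hΩ hu b (G.Ahat.algT G.Ahat p q)
      rw [h2, coe_mult_mul] at h3
      simpa only [mul_assoc] using h3
    have key2 : ∀ (q : G.Ahat.alg) (y : HTensor H K →L[ℂ] HTensor H K),
        y ∈ (G.Ahat.tensor B).alg → opT 1 (ψ q : K →L[ℂ] K) * y *
          (u : HTensor H K →L[ℂ] HTensor H K) ∈ cls (podlesSet (β.conj u hu)) := by
      intro q y hy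
      rw [← sandwich_apply_mul]
      refine map_mem_cls _ ?_ ((mem_alg_of_eq hB.action.podles).2 hy)
      rintro _ ⟨p, hp, b, rfl⟩
      rw [sandwich_apply_mul]
      exact key q ⟨p, hp⟩ b
    have h1 : x * (u : HTensor H K →L[ℂ] HTensor H K) =
        sandwich 1 (u : HTensor H K →L[ℂ] HTensor H K) x := by
      rw [sandwich_apply_mul, one_mul]
    rw [h1]
    refine map_tensor_mem_cls _ ?_ hx
    intro a ha b hb
    have h2 : opT a b = opTr a b := rfl
    rw [h2, ← ContinuousLinearMap.comp_apply]
    refine map_mem_cls _ ?_ ((mem_alg_of_eq ψ.nondeg).2 hb)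
    rintro _ ⟨q, b, hb, rfl⟩
    have h2 : (opT a ((ψ q : K →L[ℂ] K) * b) : HTensor H K →L[ℂ] HTensor H K) =
        opT 1 (ψ q : K →L[ℂ] K) * opT a b := by rw [opT_mul, one_mul]
    rw [ContinuousLinearMap.comp_apply, opTr_apply, h2, sandwich_apply_mul, one_mul]
    exact key2 q _ (CStarOp.opT_mem ha hb)

end QuantumGroup

end QG

end

theorem theorem8 {H : Type*} [NormedAddCommGroup H] [InnerProductSpace ℂ H]
    [CompleteSpace H] (G : QG.QuantumGroup H)
    (Ω : (G.Ahat.tensor G.Ahat).mult) (hΩ : G.IsUnitaryTwoCocycle Ω) (hT : G.HasTrivialTwist Ω)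
    {K : Type*} [NormedAddCommGroup K] [InnerProductSpace ℂ K] [CompleteSpace K]
    (B : QG.CStarOp K) (β : QG.Mor B (G.Ahat.tensor B)) (ψ : QG.Mor G.Ahat B)
    (hB : G.IsGProduct B β ψ) :
    ∃ βΩ : QG.Mor B (G.Ahat.tensor B),
      (∀ b : B.alg, βΩ b =
        star ((QG.Mor.idTensor G.Ahat ψ).ext Ω) * β b * (QG.Mor.idTensor G.Ahat ψ).ext Ω) ∧
      G.IsContinuousLeftAction B βΩ ∧ G.IsGProduct B βΩ ψ := by
  have hu : (QG.Mor.idTensor G.Ahat ψ).ext Ω ∈ unitary (G.Ahat.tensor B).mult :=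
    QG.Mor.ext_unitary _ hΩ.isUnitary
  have haction : G.IsContinuousLeftAction B (β.conj _ hu) :=
    { injective := β.conj_injective _ hu hB.action.injective
      coassoc := fun b => (congrArg Subtype.val (hB.coassoc_conj hΩ hT hu b)).trans
        (QG.QuantumGroup.coe_comulMor_ext _)
      podles := hB.podles_conj hT hΩ.isUnitary hu }
  refine ⟨β.conj _ hu, fun b => rfl, haction, haction, hB.injective, fun a => ?_⟩
  -- All three factors of U* (id ⊗ ψ)(Δ̂(a)) U are images under id ⊗ ψ, so the product is the image
  -- of Ω*Δ̂(a)Ω, which is Δ̂(a).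
  rw [QG.Mor.conj_ext, hB.comm, ← map_star, ← map_mul, ← map_mul, hT a]
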